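/- **Theorem (spatial decay of the Kalman gain).** Consider on $L^2(\mathbb R)$ the spatially invariant plant $\dot\psi=\mathcal A\psi+\mathcal B w$ with noisy measurements of the full state $y=\psi+\mathcal G v$, where $w,v$ are independent white noises with identity covariance. Here $\mathcal A$ is a densely defined constant-coefficient differential operator on its natural domain which generates a $C_0$-semigroup, with polynomial Fourier symbol $\hat{\mathcal A}_\lambda$; $\mathcal B,\mathcal G$ are bounded operators whose Fourier symbols are proper rational functions without zeros and without real poles, $\hat{\mathcal B}_\lambda=b/p_{\mathcal B}(\lambda)$, $\hat{\mathcal G}_\lambda=g/p_{\mathcal G}(\lambda)$, with $b,g\neq0$ and $p_{\mathcal B},p_{\mathcal G}$ polynomials without real roots. Let $\mathcal P$ be a self-adjoint stabilizing solution of the filtering algebraic Riccati equation $\langle(\mathcal A\mathcal P+\mathcal P\mathcal A^*+\mathcal B\mathcal B^*-\mathcal P(\mathcal G\mathcal G^*)^{-1}\mathcal P)h,f\rangle=0$, $h,f\in D(\mathcal A^*)$ (the quadratic term being read as $\langle \mathcal G^{-1}\mathcal P h,\mathcal G^{-1}\mathcal P f\rangle$; stabilizing means that the closed loop $\mathcal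 A-\mathcal L$ is exponentially stable, in the sense that $\mathcal A^*-\mathcal L^*$ generates an exponentially stable $C_0$-semigroup), where $\mathcal L=\mathcal P(\mathcal G\mathcal G^*)^{-1}$, with domain the range of $\mathcal G\mathcal G^*$, is the Kalman gain. Then $\mathcal L$ has the Fourier symbol $$\hat{\mathcal L}_\lambda=\Re\hat{\mathcal A}_\lambda+\sqrt{(\Re\hat{\mathcal A}_\lambda)^2+|\hat{\mathcal B}_\lambda/\hat{\mathcal G}_\lambda|^2},\qquad\lambda\in\mathbb R.$$ Let $Q(z)$ and $R(z)$ be the polynomial $\Re\hat{\mathcal A}_\lambda$ and the rational function $(\Re\hat{\mathcal A}_\lambda)^2+|\hat{\mathcal B}_\lambda/\hat{\mathcal G}_\lambda|^2$ of $\lambda$, with $\lambda$ replaced by $-\mathbf i z$, $z\in\mathbb C$. Call the zeros and the poles of $R$ the finite branch points of the extended symbol, and let $\theta$ be the minimum of $|\Re z_i|$ over the finite branch points $z_i$ ($\theta=\infty$ if there are none). Then there are only finitely many finite branch points, $\theta>0$, and: i) there is an analytic function $\hat{\mathcal L}_z$ on the strip $|\Re z|<\theta$ with $\hat{\mathcal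 L}_{\mathbf i\lambda}$ equal to the symbol $\hat{\mathcal L}_\lambda$ for all real $\lambda$, and such that $\hat{\mathcal L}_z-Q(z)$ is a square root of $R(z)$ (wherever the denominator of $R$ does not vanish); ii) for every compact $\Gamma_0\subset(-\theta,\theta)$ there are $C,N>0$ with $|\hat{\mathcal L}_z|\le C(1+|z|)^N$ whenever $\Re z\in\Gamma_0$; iii) $\mathcal L$ is the convolution operator on Schwartz functions with a tempered distribution $L$ as its kernel, and $e^{-\eta x}L$ is a tempered distribution for every real $\eta$ with $|\eta|<\theta$ (the sense in which the gain kernel decays exponentially in space, at every rate below $\theta$). -/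

import Mathlib

open MeasureTheory Filter Topology Polynomial FourierTransform ComplexConjugate
open scoped SchwartzMap LinearPMap NNReal ENNReal

noncomputable section

namespace KalmanGain

/-- The state space `L²(ℝ)`, with complex scalars. -/
abbrev L2R : Type := Lp (α := ℝ) ℂ 2 volume

/-! ### Strongly continuous semigroups -/

/-- A strongly continuous (`C₀`) semigroup of bounded operators on `X`. -/
structure C0Semigroup (X : Type*) [NormedAddCommGroup X] [NormedSpace ℂ X] where
  op : ℝ≥0 → X →L[ℂ] X
  op_zero : op 0 = ContinuousLinearMap.id ℂ X
  op_add : ∀ s t : ℝ≥0, op (s + t) = (op s).comp (op t)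
  tendsto_op : ∀ x : X, Tendsto (fun t : ℝ≥0 => op t x) (𝓝[>] 0) (𝓝 x)

namespace C0Semigroup

variable {X : Type*} [NormedAddCommGroup X] [NormedSpace ℂ X]

/-- `A` is the infinitesimal generator of `T`: `x ∈ D(A)` and `A x = y` exactly when
`(T(t) x - x) / t → y` as `t ↓ 0`. -/
def IsGenerator (T : C0Semigroup X) (A : X →ₗ.[ℂ] X) : Prop :=
  ∀ x y : X, (x, y) ∈ A.graph ↔
    Tendsto (fun t : ℝ≥0 => ((t : ℝ) : ℂ)⁻¹ • (T.op t x - x)) (𝓝[>] 0) (𝓝 y)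

/-- Exponential stability: `‖T(t)‖ ≤ M e^{-ω t}` for some `ω > 0`. -/
def IsExponentiallyStable (T : C0Semigroup X) : Prop :=
  ∃ M ω : ℝ, 0 < ω ∧ ∀ t : ℝ≥0, ‖T.op t‖ ≤ M * Real.exp (-ω * t)

end C0Semigroup

/-! ### Fourier symbols

The spatial frequency is `lam`, dual to `x` through `e^{-i lam x}`; the Fourier transform `𝓕` of
Mathlib uses `e^{-2 π i ξ x}`, so `lam = 2 π ξ`. The normalization in front of the integral plays
no role for multipliers. -/

/-- The operator `T` is diagonalized by the Fourier transform, with symbol `m`: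
`(T f)^(lam) = m(lam) * f^(lam)` for `f ∈ D(T)`. -/
def HasFourierSymbol (T : L2R →ₗ.[ℂ] L2R) (m : ℝ → ℂ) : Prop :=
  ∀ f y : L2R, (f, y) ∈ T.graph →
    ∀ᵐ ξ : ℝ, (𝓕 y : L2R) ξ = m (2 * Real.pi * ξ) * (𝓕 f : L2R) ξ

/-- The bounded operator `T` on all of `L²(ℝ)` has Fourier symbol `m`. -/
def HasBoundedFourierSymbol (T : L2R →L[ℂ] L2R) (m : ℝ → ℂ) : Prop :=
  ∀ f : L2R, ∀ᵐ ξ : ℝ, (𝓕 (T f) : L2R) ξ = m (2 * Real.pi * ξ) * (𝓕 f : L2R) ξ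

/-- `A` is the constant coefficient differential operator on `L²(ℝ)` with polynomial Fourier
symbol `a`, on its natural domain `{f ∈ L² : a(lam) f^(lam) ∈ L²}`. -/
def IsDifferentialOperator (A : L2R →ₗ.[ℂ] L2R) (a : ℂ[X]) : Prop :=
  ∀ f y : L2R, (f, y) ∈ A.graph ↔
    ∀ᵐ ξ : ℝ, (𝓕 y : L2R) ξ =
      a.eval ((2 * Real.pi * ξ : ℝ) : ℂ) * (𝓕 f : L2R) ξ

/-! ### The Kalman gain, for noisy measurements of the full state (`C = I`) -/

/-- The inverse `(G G*)⁻¹`, with domain the range of `G G*`. -/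
def noiseCovInv (G : L2R →L[ℂ] L2R) : L2R →ₗ.[ℂ] L2R :=
  LinearPMap.inverse
    (((G.comp (ContinuousLinearMap.adjoint G) : L2R →L[ℂ] L2R) : L2R →ₗ[ℂ] L2R).toPMap ⊤)

/-- The Kalman gain operator `L = P C* (G G*)⁻¹` with `C = I`. -/
def kalmanGain (G P : L2R →L[ℂ] L2R) : L2R →ₗ.[ℂ] L2R :=
  (P : L2R →ₗ[ℂ] L2R).compPMap (noiseCovInv G)

/-- The algebraic Riccati equation
`⟨(A P + P A* + B B* - P C* (G G*)⁻¹ C P) h, f⟩ = 0` for all `h, f ∈ D(A*)`, with `C = I`.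
Since `(G G*)⁻¹` may be unbounded, the quadratic term is read as the form
`⟨(G G*)⁻¹ P h, P f⟩ = ⟨G⁻¹ P h, G⁻¹ P f⟩`; here `u = G⁻¹ P h` and `w = G⁻¹ P f`.
(Mathlib's `inner ℂ` is conjugate linear in its first argument.) -/
def SatisfiesRiccati (A : L2R →ₗ.[ℂ] L2R) (B G P : L2R →L[ℂ] L2R) : Prop :=
  ∀ h h' f f' : L2R, (h, h') ∈ A†.graph → (f, f') ∈ A†.graph →
    ∃ u w : L2R, G u = P h ∧ G w = P f ∧
      inner ℂ f' (P h) + inner ℂ (P f) h'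
        + inner ℂ (ContinuousLinearMap.adjoint B f) (ContinuousLinearMap.adjoint B h)
        - inner ℂ w u = 0

/-- `P` is a stabilizing solution of the Riccati equation: it is self-adjoint, satisfies the
equation, and the closed loop `A - L C`, `C = I`, is exponentially stable. The closed loop
semigroup is given through its adjoint, whose generator is `A* - C* L*`: the operator
`L* = (G G*)⁻¹ P` is closed, whereas `L = P (G G*)⁻¹` need not be when `(G G*)⁻¹` is unbounded. -/
structure IsStabilizingSolution (A : L2R →ₗ.[ℂ] L2R) (B G P : L2R →L[ℂ] L2R) : Prop where
  selfAdjoint : IsSelfAdjoint P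
  riccati : SatisfiesRiccati A B G P
  stabilizing : ∃ V : C0Semigroup L2R,
    V.IsGenerator (A† - (kalmanGain G P)†) ∧ V.IsExponentiallyStable

/-! ### The symbols of the plant, the symbol of the gain and its extension -/

/-- The Fourier symbols of the plant: `A^(lam) = a(lam)` is a polynomial, and
`B^(lam) = b / pB(lam)`, `G^(lam) = g / pG(lam)` are the proper rational functions of `lam` without
zeros and without real poles. -/
structure PlantSymbols where
  a : ℂ[X]
  b : ℂ
  pB : ℂ[X]
  g : ℂ
  pG : ℂ[X]
  b_ne_zero : b ≠ 0
  g_ne_zero : g ≠ 0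
  pB_ne_zero : ∀ lam : ℝ, pB.eval (lam : ℂ) ≠ 0
  pG_ne_zero : ∀ lam : ℝ, pG.eval (lam : ℂ) ≠ 0

/-- The polynomial with conjugate coefficients. On the real line, its values are the conjugates of
those of `p`. -/
def conjPoly (p : ℂ[X]) : ℂ[X] := p.map (starRingEnd ℂ)

namespace PlantSymbols

variable (S : PlantSymbols)

/-- `B^(lam)`. -/
def symbB (lam : ℝ) : ℂ := S.b / S.pB.eval (lam : ℂ)

/-- `G^(lam)`. -/
def symbG (lam : ℝ) : ℂ := S.g / S.pG.eval (lam : ℂ)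

/-- The symbol of the gain,
`L^(lam) = Re A^(lam) + √((Re A^(lam))² + |B^(lam) / G^(lam)|²)`. -/
def gainSymbol (lam : ℝ) : ℝ :=
  (S.a.eval (lam : ℂ)).re
    + √((S.a.eval (lam : ℂ)).re ^ 2 + ‖S.symbB lam / S.symbG lam‖ ^ 2)

/-- `lam ↦ Re A^(lam)` as a polynomial in `lam`. -/
def rePoly : ℂ[X] := C (1 / 2) * (S.a + conjPoly S.a)

/-- `Re A^(lam)` with `lam` replaced by `-i z`. -/
def reExt (z : ℂ) : ℂ := S.rePoly.eval (-Complex.I * z)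

/-- `(Re A^(lam))² + |B^(lam) / G^(lam)|²` with `lam` replaced by `-i z`, where
`|B^ / G^|² = (|b|² |pG|²) / (|g|² |pB|²)` is a rational function of `lam`. -/
def radicandExt (z : ℂ) : ℂ :=
  S.reExt z ^ 2 +
    ((‖S.b‖ : ℂ) ^ 2 * (S.pG * conjPoly S.pG).eval (-Complex.I * z)) /
      ((‖S.g‖ : ℂ) ^ 2 * (S.pB * conjPoly S.pB).eval (-Complex.I * z))

/-- The finite branch points of the extension of the gain symbol: the zeros and the poles of the
extended radicand. Limits make the definition independent of common factors of the numerator and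
the denominator. -/
def branchPoints : Set ℂ :=
  {z₀ | Tendsto S.radicandExt (𝓝[≠] z₀) (𝓝 0) ∨
    Tendsto (fun z => ‖S.radicandExt z‖) (𝓝[≠] z₀) atTop}

/-- `θ`, the least `|Re z|` over the finite branch points (`∞` if there are none). -/
def decayRate : ℝ≥0∞ := ⨅ z ∈ S.branchPoints, ENNReal.ofReal |z.re|

/-- The strip `|Re z| < θ`. -/
def strip : Set ℂ := {z | ENNReal.ofReal |z.re| < S.decayRate}

/-- `F` is an extension of the gain symbol to the strip, under `lam ↦ -i z`: it is obtained from
the formula of the symbol by a choice of a square root of the extended radicand at each point, and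
it agrees with the symbol on the imaginary axis `z = i lam`. -/
def IsGainExtension (F : ℂ → ℂ) : Prop :=
  (∀ z ∈ S.strip, (S.pB * conjPoly S.pB).eval (-Complex.I * z) ≠ 0 →
      (F z - S.reExt z) ^ 2 = S.radicandExt z) ∧
    ∀ lam : ℝ, F (Complex.I * lam) = (S.gainSymbol lam : ℂ)

end PlantSymbols

/-! ### Convolution kernels and exponential weights -/

/-- The tempered distribution `L` is the convolution kernel of the operator `T`: every Schwartz
function `φ` is in `D(T)`, and `(T φ)(x) = ∫ L(x - ξ) φ(ξ) dξ = ⟨L, φ(x - ·)⟩` for almost every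
`x`. -/
def IsConvolutionKernel (T : L2R →ₗ.[ℂ] L2R) (L : 𝓢'(ℝ, ℂ)) : Prop :=
  ∀ φ : 𝓢(ℝ, ℂ), ∃ y : L2R, (φ.toLp 2 volume, y) ∈ T.graph ∧
    ∀ᵐ x : ℝ, ∀ ψ : 𝓢(ℝ, ℂ), (∀ s : ℝ, ψ s = φ (x - s)) → y x = L ψ

/-- The distribution `e^{-η x} L`, which acts on test functions `φ` (smooth with compact support)
by `φ ↦ ⟨L, e^{-η x} φ⟩`, is (the restriction to test functions of) a tempered distribution. -/
def IsTemperedWithWeight (η : ℝ) (L : 𝓢'(ℝ, ℂ)) : Prop :=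
  ∃ T : 𝓢'(ℝ, ℂ), ∀ φ ψ : 𝓢(ℝ, ℂ), HasCompactSupport φ →
    (∀ x : ℝ, ψ x = (Real.exp (-η * x) : ℂ) * φ x) → T φ = L ψ

end KalmanGain

end

open KalmanGain

/-!
By Plancherel every operator here becomes multiplication by a function of the frequency, but the
symbols of `A` and of `(G G*)⁻¹` are unbounded, so identities between them are tested on frequency
bands, where all symbols are bounded. There the Riccati equation reads
`2 Re A^ P^ + |B^|² = P^² / |G^|²`, whose nonnegative root `P₀ = |G^|² L^` is the expected solution.
A priori `P` need not commute with translations, so it has no symbol. However, the difference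
of `P` and the multiplier `P₀` solves a homogeneous Sylvester equation whose two coefficients are
the closed loops of `P` and of `P₀`; the first generates an exponentially stable semigroup and the
second is dissipative, which forces the difference to vanish.

In lowest terms, the numerator and the denominator of the radicand have no root in the strip
`|Re z| < θ`. Each linear factor `z - r` with `r` outside the strip has an analytic square root
inside it, hence so does the radicand, with polynomial growth on closed substrips. Shifting the
contour of the inverse Fourier integral from `Re z = 0` to `Re z = η` then multiplies the kernel by
`e^{-η x}`.
-/

namespace KalmanGain

/-! ### Fourier multipliers -/

section FourierMultiplier

theorem fourier_ae_injective {f g : L2R} (h : (𝓕 f : L2R) =ᵐ[volume] (𝓕 g : L2R)) : f = g :=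
  (Lp.fourierTransformₗᵢ ℝ ℂ).injective (Lp.ext h)

theorem inner_eq_integral_fourier (f g : L2R) :
    inner ℂ f g = ∫ ξ : ℝ, (𝓕 g : L2R) ξ * conj ((𝓕 f : L2R) ξ) := by
  rw [← Lp.inner_fourier_eq, L2.inner_def]
  rfl

/-- The Fourier multiplier `𝓕⁻¹ m 𝓕` on `L²(ℝ)` of an essentially bounded function `m`. -/
noncomputable def fourierMultiplier (m : Lp (α := ℝ) ℂ ∞ volume) : L2R →L[ℂ] L2R :=
  let U := (Lp.fourierTransformₗᵢ ℝ ℂ).toContinuousLinearEquiv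
  (U.symm : L2R →L[ℂ] L2R) ∘L (ContinuousLinearMap.mul ℂ ℂ).holderL volume ∞ 2 2 m ∘L
    (U : L2R →L[ℂ] L2R)

theorem fourier_fourierMultiplier (m : Lp (α := ℝ) ℂ ∞ volume) (f : L2R) :
    (𝓕 (fourierMultiplier m f) : L2R) =ᵐ[volume] fun ξ => m ξ * (𝓕 f : L2R) ξ := by
  have hconj : (𝓕 (fourierMultiplier m f) : L2R)
      = (ContinuousLinearMap.mul ℂ ℂ).holder 2 m (𝓕 f : L2R) :=
    (Lp.fourierTransformₗᵢ ℝ ℂ).apply_symm_apply _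
  rw [hconj]
  exact (ContinuousLinearMap.mul ℂ ℂ).coeFn_holder m (𝓕 f : L2R)

/-- The symbol `m`, as a function of `ξ = λ / 2π`, cut off to the frequency band `|ξ| ≤ R`. -/
noncomputable def bandSymbol (R : ℝ) (m : C(ℝ, ℂ)) : ℝ → ℂ :=
  (Set.Icc (-R) R).indicator fun ξ => m (2 * Real.pi * ξ)

theorem memLp_bandSymbol (R : ℝ) (m : C(ℝ, ℂ)) : MemLp (bandSymbol R m) ∞ volume := by
  have hm : Continuous fun ξ : ℝ => m (2 * Real.pi * ξ) := by fun_prop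
  obtain ⟨c, hc⟩ := (isCompact_Icc (a := -R) (b := R)).exists_bound_of_continuousOn hm.continuousOn
  exact (memLp_indicator_iff_restrict measurableSet_Icc).2 <|
    memLp_top_of_bound hm.aestronglyMeasurable c
      ((ae_restrict_iff' measurableSet_Icc).2 (ae_of_all _ hc))

theorem fourier_fourierMultiplier_bandSymbol (R : ℝ) (m : C(ℝ, ℂ)) (f : L2R) :
    (𝓕 (fourierMultiplier ((memLp_bandSymbol R m).toLp _) f) : L2R)
      =ᵐ[volume] fun ξ => bandSymbol R m ξ * (𝓕 f : L2R) ξ := by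
  filter_upwards [fourier_fourierMultiplier ((memLp_bandSymbol R m).toLp _) f,
    (memLp_bandSymbol R m).coeFn_toLp] with ξ hξ hm
  rw [hξ, hm]

theorem adjoint_fourierMultiplier_bandSymbol (R : ℝ) (m : C(ℝ, ℂ)) :
    ContinuousLinearMap.adjoint (fourierMultiplier ((memLp_bandSymbol R m).toLp _))
      = fourierMultiplier ((memLp_bandSymbol R (star m)).toLp _) := by
  symm
  rw [ContinuousLinearMap.eq_adjoint_iff]
  intro f g
  rw [inner_eq_integral_fourier, inner_eq_integral_fourier]
  apply integral_congr_ae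
  filter_upwards [fourier_fourierMultiplier_bandSymbol R m g,
    fourier_fourierMultiplier_bandSymbol R (star m) f] with ξ hm hs
  rw [hm, hs]
  by_cases h : ξ ∈ Set.Icc (-R) R <;> simp [bandSymbol, h, mul_assoc, mul_left_comm]

/-- The Fourier multiplier with symbol `m`, restricted to the frequency band `|ξ| ≤ R`. It is
bounded for every continuous `m`, so the symbols of unbounded operators, too, can be computed with
in the C⋆-algebra of bounded operators. -/
noncomputable def band (R : ℝ) : C(ℝ, ℂ) →⋆ₙₐ[ℂ] (L2R →L[ℂ] L2R) where
  toFun m := fourierMultiplier ((memLp_bandSymbol R m).toLp _)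
  map_smul' c m := by
    ext1 f
    apply fourier_ae_injective
    rw [MonoidHom.id_apply, smul_apply, FourierTransform.fourier_smul]
    filter_upwards [fourier_fourierMultiplier_bandSymbol R (c • m) f,
      fourier_fourierMultiplier_bandSymbol R m f, Lp.coeFn_smul c
        (𝓕 (fourierMultiplier ((memLp_bandSymbol R m).toLp _) f) : L2R)] with ξ hcm hm hc
    rw [hcm, hc, Pi.smul_apply, hm]
    by_cases h : ξ ∈ Set.Icc (-R) R <;> simp [bandSymbol, h, mul_assoc]
  map_zero' := by
    ext1 f
    apply fourier_ae_injective
    rw [zero_apply, FourierTransform.fourier_zero]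
    filter_upwards [fourier_fourierMultiplier_bandSymbol R 0 f, Lp.coeFn_zero ℂ 2 volume]
      with ξ hξ h0
    rw [hξ, h0]
    simp [bandSymbol]
  map_add' m n := by
    ext1 f
    apply fourier_ae_injective
    rw [add_apply, FourierTransform.fourier_add]
    filter_upwards [fourier_fourierMultiplier_bandSymbol R (m + n) f,
      fourier_fourierMultiplier_bandSymbol R m f, fourier_fourierMultiplier_bandSymbol R n f,
      Lp.coeFn_add (𝓕 (fourierMultiplier ((memLp_bandSymbol R m).toLp _) f) : L2R)
        (𝓕 (fourierMultiplier ((memLp_bandSymbol R n).toLp _) f) : L2R)] with ξ hmn hm hn hadd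
    rw [hmn, hadd, Pi.add_apply, hm, hn]
    by_cases h : ξ ∈ Set.Icc (-R) R <;> simp [bandSymbol, h, add_mul]
  map_mul' m n := by
    ext1 f
    apply fourier_ae_injective
    filter_upwards [fourier_fourierMultiplier_bandSymbol R (m * n) f,
      fourier_fourierMultiplier_bandSymbol R m
        (fourierMultiplier ((memLp_bandSymbol R n).toLp _) f),
      fourier_fourierMultiplier_bandSymbol R n f] with ξ hmn hm hn
    rw [hmn, mul_apply_eq_comp, hm, hn]
    by_cases h : ξ ∈ Set.Icc (-R) R <;> simp [bandSymbol, h, mul_assoc]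
  map_star' m := (adjoint_fourierMultiplier_bandSymbol R m).symm

theorem fourier_band (R : ℝ) (m : C(ℝ, ℂ)) (f : L2R) :
    (𝓕 (band R m f) : L2R) =ᵐ[volume] fun ξ => bandSymbol R m ξ * (𝓕 f : L2R) ξ :=
  fourier_fourierMultiplier_bandSymbol R m f

variable {R : ℝ} {m n : C(ℝ, ℂ)} {T T' : L2R →L[ℂ] L2R}

theorem adjoint_band : ContinuousLinearMap.adjoint (band R m) = band R (star m) :=
  (map_star (band R) m).symm

theorem band_mul_apply (f : L2R) : band R (m * n) f = band R m (band R n f) := by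
  rw [map_mul]
  rfl

theorem exists_nat_mem_band (ξ : ℝ) : ∃ k : ℕ, ξ ∈ Set.Icc (-(k : ℝ)) k :=
  (exists_nat_ge |ξ|).imp fun _ hk => abs_le.mp hk

theorem ae_eq_mul_fourier_of_band {f y : L2R} (h : ∀ R, band R 1 y = band R m f) :
    ∀ᵐ ξ : ℝ, (𝓕 y : L2R) ξ = m (2 * Real.pi * ξ) * (𝓕 f : L2R) ξ := by
  have hband : ∀ᵐ ξ : ℝ, ∀ k : ℕ,
      bandSymbol k 1 ξ * (𝓕 y : L2R) ξ = bandSymbol k m ξ * (𝓕 f : L2R) ξ := by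
    rw [ae_all_iff]
    intro k
    filter_upwards [fourier_band k 1 y, fourier_band k m f] with ξ hy hf
    rw [← hy, h, hf]
  filter_upwards [hband] with ξ hξ
  obtain ⟨k, hk⟩ := exists_nat_mem_band ξ
  simpa [bandSymbol, hk] using hξ k

theorem eq_of_band_one {f g : L2R} (h : ∀ R, band R 1 f = band R 1 g) : f = g :=
  fourier_ae_injective <| (ae_eq_mul_fourier_of_band h).mono fun _ hξ => by simpa using hξ

theorem band_eq_of_fourier_ae {f y : L2R}
    (h : ∀ᵐ ξ : ℝ, (𝓕 y : L2R) ξ = m (2 * Real.pi * ξ) * (𝓕 f : L2R) ξ) :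
    band R n y = band R (n * m) f := by
  apply fourier_ae_injective
  filter_upwards [fourier_band R n y, fourier_band R (n * m) f, h] with ξ hn hnm hy
  rw [hn, hnm, hy]
  by_cases hξ : ξ ∈ Set.Icc (-R) R <;> simp [bandSymbol, hξ, mul_assoc]

theorem fourier_band_ae_mul (f : L2R) :
    ∀ᵐ ξ : ℝ, (𝓕 (band R (m * n) f) : L2R) ξ
      = m (2 * Real.pi * ξ) * (𝓕 (band R n f) : L2R) ξ := by
  filter_upwards [fourier_band R (m * n) f, fourier_band R n f] with ξ hmn hn
  rw [hmn, hn]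
  by_cases h : ξ ∈ Set.Icc (-R) R <;> simp [bandSymbol, h, mul_assoc]

theorem hasBoundedFourierSymbol_iff_band :
    HasBoundedFourierSymbol T m ↔ ∀ R, band R 1 * T = band R m := by
  refine ⟨fun h R => ?_, fun h f => ae_eq_mul_fourier_of_band fun R => ?_⟩
  · ext1 f
    simpa using band_eq_of_fourier_ae (R := R) (n := 1) (h f)
  · rw [← h R]
    rfl

theorem HasBoundedFourierSymbol.mul_band (hT : HasBoundedFourierSymbol T m) :
    T * band R n = band R (m * n) := by
  ext1 f
  apply fourier_ae_injective
  filter_upwards [hT (band R n f), fourier_band_ae_mul (R := R) (m := m) (n := n) f] with ξ hTξ hmn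
  rw [hmn, ← hTξ]
  rfl

theorem HasBoundedFourierSymbol.adjoint (hT : HasBoundedFourierSymbol T m) :
    HasBoundedFourierSymbol (ContinuousLinearMap.adjoint T) (star m : C(ℝ, ℂ)) := by
  rw [hasBoundedFourierSymbol_iff_band]
  intro R
  simpa only [star_mul, ← map_star, star_one, mul_one, ContinuousLinearMap.star_eq_adjoint] using
    congrArg star (hT.mul_band (R := R) (n := 1))

theorem HasBoundedFourierSymbol.comp (hT : HasBoundedFourierSymbol T m)
    (hT' : HasBoundedFourierSymbol T' n) : HasBoundedFourierSymbol (T ∘L T') (m * n : C(ℝ, ℂ)) := by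
  intro f
  filter_upwards [hT (T' f), hT' f] with ξ hξ hξ'
  rw [ContinuousLinearMap.comp_apply, hξ, hξ', ContinuousMap.coe_mul, Pi.mul_apply]
  exact (mul_assoc _ _ _).symm

theorem HasBoundedFourierSymbol.injective (hT : HasBoundedFourierSymbol T m)
    (hm : ∀ lam, m lam ≠ 0) : Function.Injective T := by
  intro f g hfg
  apply fourier_ae_injective
  filter_upwards [hT f, hT g] with ξ hf hg
  rw [hfg, hg] at hf
  exact (mul_left_cancel₀ (hm _) hf).symm

theorem re_inner_band_nonpos (hm : ∀ lam, (m lam).re ≤ 0) (u : L2R) :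
    (inner ℂ u (band R m u)).re ≤ 0 := by
  let k : C(ℝ, ℂ) := ⟨fun lam => (√(-(m lam).re) : ℂ), by fun_prop⟩
  have hmk : m + star m = -(2 : ℂ) • (star k * k) := by
    ext lam
    have hk : star k lam * k lam = ((-(m lam).re : ℝ) : ℂ) := by
      change conj ((√(-(m lam).re) : ℝ) : ℂ) * ((√(-(m lam).re) : ℝ) : ℂ) = _
      rw [Complex.conj_ofReal, ← Complex.ofReal_mul,
        Real.mul_self_sqrt (neg_nonneg.mpr (hm lam))]
    change m lam + conj (m lam) = -(2 : ℂ) • (star k lam * k lam)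
    rw [hk, Complex.add_conj, smul_eq_mul]
    push_cast
    ring
  have hinner : inner ℂ u (band R m u) + conj (inner ℂ u (band R m u))
      = -2 * inner ℂ (band R k u) (band R k u) := by
    rw [inner_conj_symm, ← ContinuousLinearMap.adjoint_inner_right, ← inner_add_right,
      adjoint_band, ← add_apply, ← map_add, hmk, map_smul, map_mul, ← adjoint_band, smul_apply,
      inner_smul_right, mul_apply_eq_comp, ContinuousLinearMap.adjoint_inner_right]
  have hnorm : (inner ℂ (band R k u) (band R k u)).re = ‖band R k u‖ ^ 2 :=
    inner_self_eq_norm_sq (𝕜 := ℂ) _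
  have hre := congrArg Complex.re hinner
  simp only [Complex.add_re, Complex.conj_re, Complex.mul_re, Complex.neg_re, Complex.re_ofNat,
    Complex.neg_im, Complex.im_ofNat, neg_zero, zero_mul, sub_zero, hnorm] at hre
  linarith [sq_nonneg ‖band R k u‖]

end FourierMultiplier

/-! ### Strongly continuous semigroups -/

namespace C0Semigroup

variable {X : Type*} [NormedAddCommGroup X] [NormedSpace ℂ X] {V : C0Semigroup X}
  {A : X →ₗ.[ℂ] X} {M : ℝ}

theorem IsExponentiallyStable.exists_bound (hV : V.IsExponentiallyStable) :
    ∃ M, ∀ t, ‖V.op t‖ ≤ M := by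
  obtain ⟨M, ω, hω, hM⟩ := hV
  have hM0 : 0 ≤ M := by simpa using (norm_nonneg _).trans (hM 0)
  refine ⟨M, fun t => (hM t).trans (mul_le_of_le_one_right hM0 (Real.exp_le_one_iff.mpr ?_))⟩
  exact mul_nonpos_of_nonpos_of_nonneg (neg_nonpos.mpr hω.le) t.coe_nonneg

theorem norm_op_sub_op_le (hM : ∀ t, ‖V.op t‖ ≤ M) (x : X) (s t : ℝ≥0) :
    ‖V.op t x - V.op s x‖ ≤ M * ‖V.op (nndist t s) x - x‖ := by
  wlog hst : s ≤ t generalizing s t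
  · rw [norm_sub_rev, nndist_comm]
    exact this t s (le_of_not_ge hst)
  obtain ⟨r, rfl⟩ := exists_add_of_le hst
  have hr : nndist (s + r) s = r := by
    rw [NNReal.nndist_eq, add_tsub_cancel_left, tsub_eq_zero_of_le hst, max_eq_left zero_le]
  rw [hr, V.op_add, ContinuousLinearMap.comp_apply, ← map_sub]
  exact (V.op s).le_of_opNorm_le (hM s) _

theorem continuous_op (hM : ∀ t, ‖V.op t‖ ≤ M) (x : X) : Continuous fun t => V.op t x := by
  have h0 : Tendsto (fun t => V.op t x) (𝓝 0) (𝓝 x) := by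
    have h : ContinuousWithinAt (fun t => V.op t x) (Set.Ioi 0) 0 := by
      simpa [ContinuousWithinAt, V.op_zero] using V.tendsto_op x
    have huniv : Set.Ici (0 : ℝ≥0) = Set.univ := Set.eq_univ_of_forall fun t => t.2
    simpa [ContinuousWithinAt, V.op_zero, huniv] using continuousWithinAt_Ioi_iff_Ici.mp h
  refine continuous_iff_continuousAt.mpr fun s => ?_
  have hdist : Tendsto (fun t => nndist t s) (𝓝 s) (𝓝 0) := by
    simpa using (continuous_id.nndist (continuous_const (y := s))).tendsto s
  rw [ContinuousAt, tendsto_iff_norm_sub_tendsto_zero]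
  refine squeeze_zero (fun _ => norm_nonneg _) (norm_op_sub_op_le hM x s) ?_
  simpa using ((h0.comp hdist).sub_const x).norm.const_mul M

/-- The orbit `t ↦ V(t) x`, as a function of a real time; it is constant for `t ≤ 0`. -/
def orbit (V : C0Semigroup X) (x : X) (t : ℝ) : X := V.op t.toNNReal x

theorem orbit_zero (x : X) : V.orbit x 0 = x := by simp [orbit, V.op_zero]

theorem orbit_add (x : X) {s t : ℝ} (hs : 0 ≤ s) (ht : 0 ≤ t) :
    V.orbit x (s + t) = V.op s.toNNReal (V.orbit x t) := by
  rw [orbit, Real.toNNReal_add hs ht, V.op_add]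
  rfl

theorem continuous_orbit (hM : ∀ t, ‖V.op t‖ ≤ M) (x : X) : Continuous (V.orbit x) :=
  (continuous_op hM x).comp continuous_real_toNNReal

theorem IsExponentiallyStable.tendsto_orbit (hV : V.IsExponentiallyStable) (x : X) :
    Tendsto (V.orbit x) atTop (𝓝 0) := by
  obtain ⟨M, ω, hω, hM⟩ := hV
  have hexp : Tendsto (fun t : ℝ => M * Real.exp (-ω * t) * ‖x‖) atTop (𝓝 0) := by
    have : Tendsto (fun t : ℝ => Real.exp (-ω * t)) atTop (𝓝 0) :=
      Real.tendsto_exp_atBot.comp (tendsto_id.const_mul_atTop_of_neg (neg_lt_zero.mpr hω))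
    simpa using (this.const_mul M).mul_const ‖x‖
  refine squeeze_zero_norm' ?_ hexp
  filter_upwards [eventually_ge_atTop 0] with t ht
  simpa [orbit, Real.coe_toNNReal t ht] using (V.op t.toNNReal).le_of_opNorm_le (hM _) x

theorem IsGenerator.orbit_mem_graph (hA : V.IsGenerator A) {x y : X} (h : (x, y) ∈ A.graph)
    (t : ℝ) : (V.orbit x t, V.orbit y t) ∈ A.graph := by
  rw [hA] at h ⊢
  refine (((V.op t.toNNReal).continuous.tendsto y).comp h).congr fun s => ?_
  have hcomm : V.op t.toNNReal (V.op s x) = V.op s (V.op t.toNNReal x) := by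
    rw [← ContinuousLinearMap.comp_apply, ← V.op_add, add_comm, V.op_add]
    rfl
  simp only [Function.comp_apply, map_smul, map_sub, orbit, hcomm]

theorem IsGenerator.hasDerivWithinAt_orbit (hA : V.IsGenerator A) {x y : X}
    (h : (x, y) ∈ A.graph) {t : ℝ} (ht : 0 ≤ t) :
    HasDerivWithinAt (V.orbit x) (V.orbit y t) (Set.Ici t) t := by
  have hshift : Tendsto (fun s : ℝ => (s - t).toNNReal) (𝓝[>] t) (𝓝[>] 0) := by
    refine tendsto_nhdsWithin_iff.mpr ⟨?_, ?_⟩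
    · have : Continuous fun s : ℝ => (s - t).toNNReal := by fun_prop
      simpa using (this.tendsto t).mono_left nhdsWithin_le_nhds
    · filter_upwards [self_mem_nhdsWithin] with s hs
      exact Real.toNNReal_pos.mpr (sub_pos.mpr hs)
  rw [← hasDerivWithinAt_Ioi_iff_Ici, hasDerivWithinAt_iff_tendsto_slope' Set.self_notMem_Ioi]
  refine (((hA _ _).mp (hA.orbit_mem_graph h t)).comp hshift).congr' ?_
  filter_upwards [self_mem_nhdsWithin] with s hs
  have hst : 0 ≤ s - t := (sub_pos.mpr hs).le
  rw [Function.comp_apply, slope_def_module, Real.coe_toNNReal _ hst, ← V.orbit_add x hst ht,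
    sub_add_cancel, ← Complex.ofReal_inv, Complex.coe_smul]

variable [CompleteSpace X]

theorem hasDerivAt_integral_orbit (hM : ∀ t, ‖V.op t‖ ≤ M) (x : X) (t : ℝ) :
    HasDerivAt (fun t => ∫ s in (0 : ℝ)..t, V.orbit x s) (V.orbit x t) t :=
  have hc := continuous_orbit hM x
  intervalIntegral.integral_hasDerivAt_right (hc.intervalIntegrable _ _)
    hc.stronglyMeasurable.stronglyMeasurableAtFilter hc.continuousAt

theorem op_integral_orbit (hM : ∀ t, ‖V.op t‖ ≤ M) (x : X) {t : ℝ} (ht : 0 ≤ t) (s : ℝ≥0) :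
    V.op s (∫ r in (0 : ℝ)..t, V.orbit x r)
      = (∫ r in (0 : ℝ)..(t + s), V.orbit x r) - ∫ r in (0 : ℝ)..s, V.orbit x r := by
  have hint : ∀ a b : ℝ, IntervalIntegrable (V.orbit x) volume a b := fun a b =>
    (continuous_orbit hM x).intervalIntegrable a b
  have hshift : ∀ r ∈ Set.uIcc 0 t, V.op s (V.orbit x r) = V.orbit x (r + s) := by
    intro r hr
    rw [Set.uIcc_of_le ht] at hr
    rw [add_comm, V.orbit_add x s.coe_nonneg hr.1, Real.toNNReal_coe]
  rw [← (V.op s).intervalIntegral_comp_comm (hint 0 t), intervalIntegral.integral_congr hshift,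
    intervalIntegral.integral_comp_add_right, zero_add,
    intervalIntegral.integral_interval_sub_left (hint _ _) (hint _ _)]

theorem IsGenerator.integral_orbit_mem_graph (hA : V.IsGenerator A) (hM : ∀ t, ‖V.op t‖ ≤ M)
    (x : X) {t : ℝ} (ht : 0 ≤ t) :
    (∫ s in (0 : ℝ)..t, V.orbit x s, V.orbit x t - x) ∈ A.graph := by
  let I : ℝ → X := fun t => ∫ s in (0 : ℝ)..t, V.orbit x s
  have hI : HasDerivAt (fun s : ℝ => I (t + s) - I s) (V.orbit x t - x) 0 := by
    have hadd : HasDerivAt (fun s : ℝ => I (t + s)) (V.orbit x t) 0 := by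
      simpa using (hasDerivAt_integral_orbit hM x (t + 0)).comp_const_add t 0
    have hsub := hadd.sub (hasDerivAt_integral_orbit hM x 0)
    rwa [V.orbit_zero] at hsub
  have hcoe : Tendsto (fun s : ℝ≥0 => (s : ℝ)) (𝓝[>] 0) (𝓝[≠] 0) :=
    tendsto_nhdsWithin_of_tendsto_nhds_of_eventually_within _
      (NNReal.tendsto_coe.mpr (tendsto_id.mono_left nhdsWithin_le_nhds))
      (by filter_upwards [self_mem_nhdsWithin] with s hs using (NNReal.coe_pos.mpr hs).ne')
  rw [hA]
  refine ((hasDerivAt_iff_tendsto_slope.mp hI).comp hcoe).congr fun s => ?_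
  rw [op_integral_orbit hM x ht, Function.comp_apply, slope_def_module, sub_zero, add_zero,
    ← Complex.ofReal_inv, Complex.coe_smul]
  simp only [I, intervalIntegral.integral_same, sub_zero]

theorem IsGenerator.dense_domain (hA : V.IsGenerator A) (hM : ∀ t, ‖V.op t‖ ≤ M) :
    Dense (A.domain : Set X) := by
  intro x
  have hmean : Tendsto (fun t : ℝ => t⁻¹ • ∫ s in (0 : ℝ)..t, V.orbit x s) (𝓝[>] 0) (𝓝 x) := by
    simpa [V.orbit_zero] using
      (hasDerivAt_integral_orbit hM x 0).tendsto_slope_zero_right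
  refine mem_closure_of_tendsto hmean ?_
  filter_upwards [self_mem_nhdsWithin] with t ht
  rw [← Complex.coe_smul]
  exact A.domain.smul_mem _
    (LinearPMap.mem_domain_of_mem_graph (hA.integral_orbit_mem_graph hM x (le_of_lt ht)))

end C0Semigroup

/-! ### Uniqueness for the Sylvester equation -/

section Sylvester

variable {H K : Type*} [NormedAddCommGroup H] [InnerProductSpace ℂ H] [CompleteSpace H]
  [NormedAddCommGroup K] [InnerProductSpace ℂ K] [CompleteSpace K] {N : K →L[ℂ] K}

theorem hasDerivAt_exp_smul_apply (N : K →L[ℂ] K) (y : K) (t : ℝ) :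
    HasDerivAt (fun t : ℝ => NormedSpace.exp (t • N) y) (N (NormedSpace.exp (t • N) y)) t :=
  ((ContinuousLinearMap.apply ℂ K y).restrictScalars ℝ).hasFDerivAt.comp_hasDerivAt t
    (hasDerivAt_exp_smul_const' (𝕂 := ℝ) N t)

theorem norm_exp_smul_apply_le (hN : ∀ u, (inner ℂ u (N u)).re ≤ 0) (y : K) {t : ℝ} (ht : 0 ≤ t) :
    ‖NormedSpace.exp (t • N) y‖ ≤ ‖y‖ := by
  let E : ℝ → K := fun t => NormedSpace.exp (t • N) y
  have hderiv : ∀ t, HasDerivAt (fun t => ‖E t‖ ^ 2) (2 * (inner ℂ (E t) (N (E t))).re) t := by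
    intro t
    let _ : InnerProductSpace ℝ K := InnerProductSpace.complexToReal
    exact (hasDerivAt_exp_smul_apply N y t).norm_sq
  have hanti : Antitone fun t => ‖E t‖ ^ 2 := by
    refine antitone_of_deriv_nonpos (fun t => (hderiv t).differentiableAt) fun t => ?_
    rw [(hderiv t).deriv]
    linarith [hN (E t)]
  have h0 : E 0 = y := by simp [E]
  simpa [h0] using pow_le_pow_iff_left₀ (norm_nonneg _) (norm_nonneg _) two_ne_zero |>.mp (hanti ht)

/-- With `y(t) = exp(t N) y` and `x(t) = V(t) x`, the pairing `⟨D y(t), x(t)⟩` is constant in `t`,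
and it decays. -/
theorem eq_zero_of_sylvester {V : C0Semigroup H} {T : H →ₗ.[ℂ] H} (hT : V.IsGenerator T)
    (hV : V.IsExponentiallyStable) (hN : ∀ u, (inner ℂ u (N u)).re ≤ 0) {D : K →L[ℂ] H}
    (hD : ∀ (y : K) (x x' : H), (x, x') ∈ T.graph →
      inner ℂ (D y) x' + inner ℂ (D (N y)) x = 0) : D = 0 := by
  obtain ⟨M, hM⟩ := hV.exists_bound
  have hortho : ∀ (y : K) (x x' : H), (x, x') ∈ T.graph → inner ℂ (D y) x = 0 := by
    intro y x x' hx
    let E : ℝ → K := fun t => NormedSpace.exp (t • N) y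
    let φ : ℝ → ℂ := fun t => inner ℂ (D (E t)) (V.orbit x t)
    have hE : ∀ t, HasDerivAt (fun t => D (E t)) (D (N (E t))) t := fun t =>
      (D.restrictScalars ℝ).hasFDerivAt.comp_hasDerivAt t (hasDerivAt_exp_smul_apply N y t)
    have hconst : ∀ t, 0 ≤ t → φ t = φ 0 := by
      intro t ht
      refine constant_of_has_deriv_right_zero (a := 0) (b := t) ?_ (fun s hs => ?_) t
        (Set.right_mem_Icc.mpr ht)
      · exact ((continuous_iff_continuousAt.mpr fun s => (hE s).continuousAt).inner
          (C0Semigroup.continuous_orbit hM x)).continuousOn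
      · have := (hE s).hasDerivWithinAt.inner ℂ (hT.hasDerivWithinAt_orbit hx hs.1)
        rwa [hD _ _ _ (hT.orbit_mem_graph hx s)] at this
    have hlim : Tendsto φ atTop (𝓝 0) := by
      have hbound : Tendsto (fun t => ‖D‖ * ‖y‖ * ‖V.orbit x t‖) atTop (𝓝 0) := by
        simpa using (hV.tendsto_orbit x).norm.const_mul (‖D‖ * ‖y‖)
      refine squeeze_zero_norm' ?_ hbound
      filter_upwards [eventually_ge_atTop 0] with t ht
      refine (norm_inner_le_norm _ _).trans (mul_le_mul_of_nonneg_right ?_ (norm_nonneg _))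
      exact (D.le_opNorm _).trans
        (mul_le_mul_of_nonneg_left (norm_exp_smul_apply_le hN y ht) (norm_nonneg _))
    have hφ0 : φ 0 = 0 := tendsto_nhds_unique
      (tendsto_const_nhds.congr' ((eventually_ge_atTop 0).mono fun t ht => (hconst t ht).symm)) hlim
    simpa [φ, E, C0Semigroup.orbit_zero] using hφ0
  ext1 y
  refine (hT.dense_domain hM).eq_zero_of_inner_left ℂ fun x hx =>
    hortho y x _ (T.mem_graph ⟨x, hx⟩)

end Sylvester

/-! ### Graphs of unbounded operators -/

section Graphs

variable {R E F G : Type*} [Ring R] [AddCommGroup E] [Module R E] [AddCommGroup F] [Module R F]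
  [AddCommGroup G] [Module R G]

theorem exists_of_mem_graph_sub {T U : E →ₗ.[R] F} {x : E} {y : F} (h : (x, y) ∈ (T - U).graph) :
    ∃ y₁ y₂, (x, y₁) ∈ T.graph ∧ (x, y₂) ∈ U.graph ∧ y = y₁ - y₂ := by
  rw [LinearPMap.mem_graph_iff] at h
  obtain ⟨X, rfl, rfl⟩ := h
  exact ⟨_, _, T.mem_graph ⟨X, X.2.1⟩, U.mem_graph ⟨X, X.2.2⟩, LinearPMap.sub_apply _ _ X⟩

theorem mem_graph_inverse_iff {T : E →ₗ.[R] F} (hT : LinearMap.ker T.toFun = ⊥) {x : E} {y : F} :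
    (y, x) ∈ T.inverse.graph ↔ (x, y) ∈ T.graph := by
  simp [LinearPMap.inverse_graph hT]

theorem mem_graph_toPMap_top_iff {T : E →ₗ[R] F} {x : E} {y : F} :
    (x, y) ∈ (T.toPMap ⊤).graph ↔ T x = y := by
  simp [LinearPMap.mem_graph_iff]

theorem mem_graph_compPMap_iff {T : F →ₗ[R] G} {U : E →ₗ.[R] F} {x : E} {z : G} :
    (x, z) ∈ (T.compPMap U).graph ↔ ∃ y, (x, y) ∈ U.graph ∧ T y = z := by
  simp only [LinearPMap.mem_graph_iff]
  constructor
  · rintro ⟨X, hX, hX'⟩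
    exact ⟨U X, ⟨X, hX, rfl⟩, hX'⟩
  · rintro ⟨_, ⟨X, hX, rfl⟩, rfl⟩
    exact ⟨X, hX, rfl⟩

theorem mem_graph_adjoint_iff {𝕜 E F : Type*} [RCLike 𝕜] [NormedAddCommGroup E]
    [InnerProductSpace 𝕜 E] [CompleteSpace E] [NormedAddCommGroup F] [InnerProductSpace 𝕜 F]
    {T : E →ₗ.[𝕜] F} (hT : Dense (T.domain : Set E)) {x : F} {y : E} :
    (x, y) ∈ T†.graph ↔ ∀ v w, (v, w) ∈ T.graph → inner 𝕜 w x = inner 𝕜 v y := by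
  simp only [LinearPMap.adjoint_graph_eq_graph_adjoint hT, Submodule.mem_adjoint_iff, sub_eq_zero]

end Graphs

section KalmanGain

variable {G P : L2R →L[ℂ] L2R}

theorem mem_graph_kalmanGain_iff (hG : Function.Injective (G ∘L ContinuousLinearMap.adjoint G))
    {f y : L2R} :
    (f, y) ∈ (kalmanGain G P).graph ↔ ∃ s, G (ContinuousLinearMap.adjoint G s) = f ∧ P s = y := by
  have hker : LinearMap.ker (((G ∘L ContinuousLinearMap.adjoint G : L2R →L[ℂ] L2R) :
      L2R →ₗ[ℂ] L2R).toPMap ⊤).toFun = ⊥ :=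
    LinearMap.ker_eq_bot.mpr fun s t hst => Subtype.ext (hG hst)
  simp only [kalmanGain, noiseCovInv, mem_graph_compPMap_iff, mem_graph_inverse_iff hker,
    mem_graph_toPMap_top_iff]
  rfl

theorem dense_domain_kalmanGain (hG : Function.Injective (G ∘L ContinuousLinearMap.adjoint G)) :
    Dense ((kalmanGain G P).domain : Set L2R) := by
  rw [Submodule.dense_iff_topologicalClosure_eq_top, Submodule.topologicalClosure_eq_top_iff,
    Submodule.eq_bot_iff]
  refine fun v hv => hG ?_
  rw [map_zero]
  refine ext_inner_left ℂ fun s => ?_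
  rw [inner_zero_right, ContinuousLinearMap.comp_apply, ← ContinuousLinearMap.adjoint_inner_left,
    ← ContinuousLinearMap.adjoint_inner_left, ContinuousLinearMap.adjoint_adjoint]
  exact hv _ (LinearPMap.mem_domain_of_mem_graph
    ((mem_graph_kalmanGain_iff (P := P) hG).mpr ⟨s, rfl, rfl⟩))

theorem noiseCov_apply_of_mem_graph_adjoint_kalmanGain
    (hG : Function.Injective (G ∘L ContinuousLinearMap.adjoint G)) {x z : L2R}
    (h : (x, z) ∈ (kalmanGain G P)†.graph) :
    G (ContinuousLinearMap.adjoint G z) = ContinuousLinearMap.adjoint P x := by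
  refine ext_inner_left ℂ fun s => ?_
  have hs := (mem_graph_adjoint_iff (dense_domain_kalmanGain hG)).mp h _ _
    ((mem_graph_kalmanGain_iff (P := P) hG).mpr ⟨s, rfl, rfl⟩)
  rw [ContinuousLinearMap.adjoint_inner_right, hs, ← ContinuousLinearMap.adjoint_inner_left,
    ← ContinuousLinearMap.adjoint_inner_left, ContinuousLinearMap.adjoint_adjoint]

end KalmanGain

/-! ### The Riccati equation on frequency bands -/

/-- The symbol `λ ↦ a(λ)` of the constant coefficient differential operator with polynomial `a`. -/
def polySymbol (a : ℂ[X]) : C(ℝ, ℂ) := ⟨fun lam => a.eval (lam : ℂ), by fun_prop⟩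

section DifferentialOperator

variable {A : L2R →ₗ.[ℂ] L2R} {a : ℂ[X]}

theorem IsDifferentialOperator.band_mem_graph (hA : IsDifferentialOperator A a) (R : ℝ)
    (m : C(ℝ, ℂ)) (f : L2R) : (band R m f, band R (polySymbol a * m) f) ∈ A.graph := by
  rw [hA]
  filter_upwards [fourier_band_ae_mul (R := R) (m := polySymbol a) (n := m) f] with ξ hξ
  simpa [polySymbol] using hξ

theorem IsDifferentialOperator.dense_domain (hA : IsDifferentialOperator A a) :
    Dense (A.domain : Set L2R) := by
  rw [Submodule.dense_iff_topologicalClosure_eq_top, Submodule.topologicalClosure_eq_top_iff,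
    Submodule.eq_bot_iff]
  refine fun v hv => eq_of_band_one fun R => ?_
  rw [map_zero]
  refine ext_inner_left ℂ fun f => ?_
  rw [inner_zero_right, ← ContinuousLinearMap.adjoint_inner_left, adjoint_band]
  exact hv _ (LinearPMap.mem_domain_of_mem_graph (hA.band_mem_graph R _ f))

theorem IsDifferentialOperator.band_mem_graph_adjoint (hA : IsDifferentialOperator A a) (R : ℝ)
    (m : C(ℝ, ℂ)) (f : L2R) : (band R m f, band R (star (polySymbol a) * m) f) ∈ A†.graph := by
  rw [mem_graph_adjoint_iff hA.dense_domain]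
  intro v w hvw
  have hw : band R (star m) w = band R (star m * polySymbol a) v :=
    band_eq_of_fourier_ae (m := polySymbol a) <| by simpa [polySymbol] using (hA v w).mp hvw
  rw [← ContinuousLinearMap.adjoint_inner_left, ← ContinuousLinearMap.adjoint_inner_left,
    adjoint_band, adjoint_band, hw, star_mul, star_star]

end DifferentialOperator

section Riccati

variable {A : L2R →ₗ.[ℂ] L2R} {B G P : L2R →L[ℂ] L2R} {a : ℂ[X]} {β γ κ : C(ℝ, ℂ)}

theorem HasBoundedFourierSymbol.mul_adjoint (hG : HasBoundedFourierSymbol G γ) :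
    HasBoundedFourierSymbol (G ∘L ContinuousLinearMap.adjoint G) (γ * star γ : C(ℝ, ℂ)) :=
  hG.comp hG.adjoint

theorem injective_noiseCov (hG : HasBoundedFourierSymbol G γ) (hγ : ∀ lam, γ lam ≠ 0) :
    Function.Injective (G ∘L ContinuousLinearMap.adjoint G) :=
  hG.mul_adjoint.injective fun lam => by simpa using hγ lam

theorem SatisfiesRiccati.inner_band (hric : SatisfiesRiccati A B G P) (hP : IsSelfAdjoint P)
    (hA : IsDifferentialOperator A a) (hB : HasBoundedFourierSymbol B β)
    (hG : HasBoundedFourierSymbol G γ) (hγ : ∀ lam, γ lam ≠ 0) (R : ℝ) (y : L2R) {x x' z : L2R}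
    (hx : (x, x') ∈ A†.graph) (hz : G (ContinuousLinearMap.adjoint G z) = P x) :
    inner ℂ (P (band R (star (polySymbol a)) y)) x + inner ℂ (P (band R 1 y)) x' +
      inner ℂ (band R (β * star β) y) x - inner ℂ (P (band R 1 y)) z = 0 := by
  have hy : (band R 1 y, band R (star (polySymbol a)) y) ∈ A†.graph := by
    simpa only [mul_one] using hA.band_mem_graph_adjoint R 1 y
  obtain ⟨u, w, hu, hw, h⟩ := hric x x' _ _ hx hy
  have hu' : u = ContinuousLinearMap.adjoint G z := hG.injective hγ (hu.trans hz.symm)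
  have hBB : B (ContinuousLinearMap.adjoint B (band R 1 y)) = band R (β * star β) y := by
    have h := hB.mul_adjoint.mul_band (R := R) (n := 1)
    rw [mul_one] at h
    exact DFunLike.congr_fun h y
  rw [hu', ContinuousLinearMap.adjoint_inner_right G, hw,
    ContinuousLinearMap.adjoint_inner_right B, hBB, ← ContinuousLinearMap.adjoint_inner_left P,
    hP.adjoint_eq] at h
  exact h

/-- If `κ` solves the Riccati equation on the level of symbols, the difference of `P` and the
multiplier with symbol `|γ|² κ` solves a homogeneous Sylvester equation. -/
theorem SatisfiesRiccati.sylvester (hric : SatisfiesRiccati A B G P) (hP : IsSelfAdjoint P)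
    (hA : IsDifferentialOperator A a) (hB : HasBoundedFourierSymbol B β)
    (hG : HasBoundedFourierSymbol G γ) (hγ : ∀ lam, γ lam ≠ 0)
    (hκ : β * star β + γ * star γ * κ * (star (polySymbol a) - κ)
      + polySymbol a * (γ * star γ * κ) = 0)
    (R : ℝ) (y : L2R) {x x' z : L2R} (hx : (x, x') ∈ A†.graph)
    (hz : G (ContinuousLinearMap.adjoint G z) = P x) :
    inner ℂ (P (band R 1 y) - band R (γ * star γ * κ) y) (x' - z) +
      inner ℂ (P (band R (star (polySymbol a) - κ) y)
        - band R (γ * star γ * κ * (star (polySymbol a) - κ)) y) x = 0 := by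
  have hriccati := hric.inner_band hP hA hB hG hγ R y hx hz
  have hgain : inner ℂ (P (band R κ y)) x = inner ℂ (band R (γ * star γ * κ) y) z := by
    rw [← ContinuousLinearMap.adjoint_inner_right P, hP.adjoint_eq, ← hz,
      ← ContinuousLinearMap.adjoint_inner_left G, ContinuousLinearMap.adjoint_inner_right G,
      ← hG.mul_adjoint.mul_band, mul_apply_eq_comp, ContinuousLinearMap.comp_apply]
  have hadjoint : inner ℂ (band R (γ * star γ * κ) y) x'
      = inner ℂ (band R (polySymbol a * (γ * star γ * κ)) y) x :=
    ((mem_graph_adjoint_iff hA.dense_domain).mp hx _ _ (hA.band_mem_graph R _ y)).symm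
  have hsymbol : inner ℂ (band R (β * star β) y) x
      + inner ℂ (band R (γ * star γ * κ * (star (polySymbol a) - κ)) y) x
      + inner ℂ (band R (polySymbol a * (γ * star γ * κ)) y) x = 0 := by
    rw [← inner_add_left, ← inner_add_left, ← add_apply, ← add_apply, ← map_add, ← map_add, hκ,
      map_zero, zero_apply, inner_zero_left]
  have hloop : P (band R (star (polySymbol a) - κ) y)
      = P (band R (star (polySymbol a)) y) - P (band R κ y) := by
    rw [map_sub, sub_apply, map_sub]
  rw [hloop]
  simp only [inner_sub_left, inner_sub_right]
  linear_combination hriccati - hgain - hadjoint - hsymbol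

theorem IsStabilizingSolution.hasBoundedFourierSymbol (hP : IsStabilizingSolution A B G P)
    (hA : IsDifferentialOperator A a) (hB : HasBoundedFourierSymbol B β)
    (hG : HasBoundedFourierSymbol G γ) (hγ : ∀ lam, γ lam ≠ 0) (hκ_star : star κ = κ)
    (hκ : β * star β + γ * star γ * κ * (star (polySymbol a) - κ)
      + polySymbol a * (γ * star γ * κ) = 0)
    (hκ_loop : ∀ lam, ((star (polySymbol a) - κ) lam).re ≤ 0) :
    HasBoundedFourierSymbol P (γ * star γ * κ : C(ℝ, ℂ)) := by
  obtain ⟨V, hgen, hV⟩ := hP.stabilizing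
  rw [hasBoundedFourierSymbol_iff_band]
  intro R
  have hzero : (P - band R (γ * star γ * κ)) ∘L band R 1 = 0 := by
    refine eq_zero_of_sylvester hgen hV (N := band R (star (polySymbol a) - κ))
      (re_inner_band_nonpos hκ_loop) fun y x xz hx => ?_
    obtain ⟨x', z, hx', hz, rfl⟩ := exists_of_mem_graph_sub hx
    have hGz := noiseCov_apply_of_mem_graph_adjoint_kalmanGain (injective_noiseCov hG hγ) hz
    rw [hP.selfAdjoint.adjoint_eq] at hGz
    simpa only [ContinuousLinearMap.comp_apply, sub_apply, ← band_mul_apply, mul_one, one_mul]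
      using hP.riccati.sylvester hP.selfAdjoint hA hB hG hγ hκ R y hx' hGz
  have hPband : P * band R 1 = band R (γ * star γ * κ) := by
    rw [← sub_eq_zero, ← hzero]
    ext1 y
    simp only [ContinuousLinearMap.comp_apply, sub_apply, ← band_mul_apply, mul_one,
      mul_apply_eq_comp]
  have hstar : star (γ * star γ * κ) = γ * star γ * κ := by
    rw [star_mul, star_mul, star_star, hκ_star, mul_comm]
  have hbandP := congrArg star hPband
  rwa [star_mul, hP.selfAdjoint.star_eq, ← map_star, ← map_star, star_one, hstar] at hbandP

theorem hasFourierSymbol_kalmanGain (hG : HasBoundedFourierSymbol G γ) (hγ : ∀ lam, γ lam ≠ 0)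
    (hP : HasBoundedFourierSymbol P (γ * star γ * κ : C(ℝ, ℂ))) :
    HasFourierSymbol (kalmanGain G P) κ := by
  intro f y hfy
  obtain ⟨s, rfl, rfl⟩ := (mem_graph_kalmanGain_iff (injective_noiseCov hG hγ)).mp hfy
  filter_upwards [hP s, hG.mul_adjoint s] with ξ hPs hGs
  rw [ContinuousLinearMap.comp_apply] at hGs
  rw [hPs, hGs, mul_comm _ κ, ContinuousMap.mul_apply, mul_assoc]

end Riccati

namespace PlantSymbols

variable (S : PlantSymbols)

theorem symbG_ne_zero (lam : ℝ) : S.symbG lam ≠ 0 := div_ne_zero S.g_ne_zero (S.pG_ne_zero lam)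

theorem continuous_symbB : Continuous S.symbB :=
  continuous_const.div (by fun_prop) S.pB_ne_zero

theorem continuous_symbG : Continuous S.symbG :=
  continuous_const.div (by fun_prop) S.pG_ne_zero

/-- The radicand `(Re A^(lam))² + |B^(lam) / G^(lam)|²` in the symbol of the gain. -/
noncomputable def radicand (lam : ℝ) : ℝ :=
  (S.a.eval (lam : ℂ)).re ^ 2 + ‖S.symbB lam / S.symbG lam‖ ^ 2

theorem radicand_pos (lam : ℝ) : 0 < S.radicand lam := by
  have : ‖S.symbB lam / S.symbG lam‖ ≠ 0 := norm_ne_zero_iff.mpr <|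
    div_ne_zero (div_ne_zero S.b_ne_zero (S.pB_ne_zero lam)) (S.symbG_ne_zero lam)
  rw [radicand]
  positivity

theorem gainSymbol_eq (lam : ℝ) :
    S.gainSymbol lam = (S.a.eval (lam : ℂ)).re + √(S.radicand lam) := rfl

theorem continuous_radicand : Continuous S.radicand :=
  have hBG := S.continuous_symbB.div S.continuous_symbG S.symbG_ne_zero
  Continuous.add (by fun_prop) (hBG.norm.pow 2)

theorem continuous_gainSymbol : Continuous S.gainSymbol :=
  Continuous.add (by fun_prop) S.continuous_radicand.sqrt

/-- The symbol `B^` as a bundled continuous function. -/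
noncomputable def contB : C(ℝ, ℂ) := ⟨S.symbB, S.continuous_symbB⟩

/-- The symbol `G^` as a bundled continuous function. -/
noncomputable def contG : C(ℝ, ℂ) := ⟨S.symbG, S.continuous_symbG⟩

/-- The symbol `L^` of the gain as a bundled continuous function with complex values. -/
noncomputable def contGain : C(ℝ, ℂ) :=
  ⟨fun lam => (S.gainSymbol lam : ℂ), Complex.continuous_ofReal.comp S.continuous_gainSymbol⟩

theorem star_contGain : star S.contGain = S.contGain := by
  ext lam
  exact Complex.conj_ofReal _

theorem gainSymbol_sq (lam : ℝ) : S.gainSymbol lam ^ 2 =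
    2 * (S.a.eval (lam : ℂ)).re * S.gainSymbol lam + ‖S.symbB lam / S.symbG lam‖ ^ 2 := by
  have hsqrt : √(S.radicand lam) ^ 2 =
      (S.a.eval (lam : ℂ)).re ^ 2 + ‖S.symbB lam / S.symbG lam‖ ^ 2 :=
    Real.sq_sqrt (S.radicand_pos lam).le
  rw [gainSymbol_eq]
  linear_combination hsqrt

theorem riccati_symbol : S.contB * star S.contB
    + S.contG * star S.contG * S.contGain * (star (polySymbol S.a) - S.contGain)
    + polySymbol S.a * (S.contG * star S.contG * S.contGain) = 0 := by
  ext lam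
  have hBG : ‖S.symbB lam‖ ^ 2 = ‖S.symbG lam‖ ^ 2 *
      (S.gainSymbol lam ^ 2 - 2 * (S.a.eval (lam : ℂ)).re * S.gainSymbol lam) := by
    have := norm_ne_zero_iff.mpr (S.symbG_ne_zero lam)
    rw [S.gainSymbol_sq, add_sub_cancel_left, norm_div]
    field_simp
  have hA := Complex.add_conj (S.a.eval (lam : ℂ))
  have hBG' := congrArg ((↑) : ℝ → ℂ) hBG
  simp only [polySymbol, contB, contG, contGain, ContinuousMap.add_apply,
    ContinuousMap.mul_apply, ContinuousMap.sub_apply, ContinuousMap.star_apply,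
    ContinuousMap.coe_mk, ContinuousMap.zero_apply, RCLike.star_def, Complex.mul_conj']
  push_cast at hA hBG' ⊢
  linear_combination hBG' + (‖S.symbG lam‖ : ℂ) ^ 2 * (S.gainSymbol lam : ℂ) * hA

theorem re_star_polySymbol_sub_contGain_nonpos (lam : ℝ) :
    ((star (polySymbol S.a) - S.contGain) lam).re ≤ 0 := by
  simp only [polySymbol, contGain, gainSymbol_eq, ContinuousMap.sub_apply, ContinuousMap.star_apply,
    ContinuousMap.coe_mk, RCLike.star_def, Complex.sub_re, Complex.conj_re, Complex.ofReal_re]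
  rw [sub_add_cancel_left, neg_nonpos]
  exact Real.sqrt_nonneg _

theorem hasFourierSymbol_kalmanGain {A : L2R →ₗ.[ℂ] L2R} {B G P : L2R →L[ℂ] L2R}
    (hA : IsDifferentialOperator A S.a) (hB : HasBoundedFourierSymbol B S.symbB)
    (hG : HasBoundedFourierSymbol G S.symbG) (hP : IsStabilizingSolution A B G P) :
    HasFourierSymbol (kalmanGain G P) fun lam => (S.gainSymbol lam : ℂ) :=
  KalmanGain.hasFourierSymbol_kalmanGain (γ := S.contG) (κ := S.contGain) hG S.symbG_ne_zero <|
    hP.hasBoundedFourierSymbol (β := S.contB) hA hB hG S.symbG_ne_zero S.star_contGain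
      S.riccati_symbol S.re_star_polySymbol_sub_contGain_nonpos

end PlantSymbols

/-! ### Square roots of rational functions on a vertical strip -/

/-- The strip `|Re z| < θ`, which is `PlantSymbols.strip` for a general width. -/
def vstrip (θ : ℝ≥0∞) : Set ℂ := {z | ENNReal.ofReal |z.re| < θ}

/-- Growth of order `|z|^N` on the closed vertical strips inside `|Re z| < θ`, with constants
depending on the closed strip. -/
def HasPolyGrowth (θ : ℝ≥0∞) (F : ℂ → ℂ) : Prop :=
  ∀ K : Set ℝ, IsCompact K → (∀ r ∈ K, ENNReal.ofReal |r| < θ) →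
    ∃ (c : ℝ) (N : ℕ), 0 < c ∧ 0 < N ∧ ∀ z : ℂ, z.re ∈ K → ‖F z‖ ≤ c * (1 + ‖z‖) ^ N

section Strip

variable {θ : ℝ≥0∞}

theorem norm_eval_le_sum_norm_coeff_mul (p : ℂ[X]) (z : ℂ) :
    ‖p.eval z‖ ≤ (∑ i ∈ Finset.range (p.natDegree + 1), ‖p.coeff i‖) *
      (1 + ‖z‖) ^ p.natDegree := by
  rw [eval_eq_sum_range, Finset.sum_mul]
  refine norm_sum_le_of_le _ fun i hi => ?_
  have hz := norm_nonneg z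
  rw [norm_mul, norm_pow]
  gcongr
  calc ‖z‖ ^ i ≤ (1 + ‖z‖) ^ i := by gcongr; linarith
    _ ≤ (1 + ‖z‖) ^ p.natDegree :=
      pow_le_pow_right₀ (by linarith) (Nat.lt_succ_iff.mp (Finset.mem_range.mp hi))

theorem hasPolyGrowth_eval (p : ℂ[X]) : HasPolyGrowth θ fun z => p.eval z := by
  refine fun K _ _ => ⟨∑ i ∈ Finset.range (p.natDegree + 1), ‖p.coeff i‖ + 1, p.natDegree + 1,
    by positivity, by positivity, fun z _ => (norm_eval_le_sum_norm_coeff_mul p z).trans ?_⟩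
  gcongr <;> simp

theorem HasPolyGrowth.add {F G : ℂ → ℂ} (hF : HasPolyGrowth θ F) (hG : HasPolyGrowth θ G) :
    HasPolyGrowth θ fun z => F z + G z := by
  intro K hK hK'
  obtain ⟨c, N, hc, hN, hF⟩ := hF K hK hK'
  obtain ⟨c', N', hc', -, hG⟩ := hG K hK hK'
  refine ⟨c + c', N + N', by positivity, by positivity, fun z hz => ?_⟩
  have h1 : 1 ≤ 1 + ‖z‖ := by simp
  rw [add_mul]
  refine norm_add_le_of_le ((hF z hz).trans ?_) ((hG z hz).trans ?_) <;> gcongr <;> simp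

theorem HasPolyGrowth.of_sq_eq {F s : ℂ → ℂ} (hF : HasPolyGrowth θ F)
    (hs : ∀ z ∈ vstrip θ, s z ^ 2 = F z) : HasPolyGrowth θ s := by
  intro K hK hK'
  obtain ⟨c, N, hc, hN, hF⟩ := hF K hK hK'
  refine ⟨1 + c, N, by positivity, hN, fun z hz => ?_⟩
  have hsq : ‖s z‖ ^ 2 ≤ c * (1 + ‖z‖) ^ N := by
    rw [← norm_pow, hs z (hK' _ hz)]
    exact hF z hz
  have h1 : 1 ≤ (1 + ‖z‖) ^ N := one_le_pow₀ (by simp)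
  nlinarith [sq_nonneg (‖s z‖ - 1), norm_nonneg (s z)]

theorem eval_eq_leadingCoeff_mul_prod_sub (p : ℂ[X]) (z : ℂ) :
    p.eval z = p.leadingCoeff * (p.roots.map fun r => z - r).prod :=
  (IsAlgClosed.splits p).eval_eq_prod_roots z

theorem exists_pos_le_norm_sub_of_re_notMem {K : Set ℝ} (hK : IsClosed K) {r : ℂ}
    (hr : r.re ∉ K) : ∃ c : ℝ, 0 < c ∧ ∀ z : ℂ, z.re ∈ K → c ≤ ‖z - r‖ := by
  obtain ⟨ε, hε, hball⟩ := Metric.isOpen_iff.mp hK.isOpen_compl r.re hr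
  refine ⟨ε, hε, fun z hz => ?_⟩
  have hdist : ε ≤ dist z.re r.re := not_lt.mp fun h => hball h hz
  exact hdist.trans (by simpa [Real.dist_eq] using Complex.abs_re_le_norm (z - r))

theorem exists_pos_le_norm_eval_of_re_mem {K : Set ℝ} (hK : IsClosed K) {p : ℂ[X]}
    (hp : ∀ z : ℂ, z.re ∈ K → p.eval z ≠ 0) :
    ∃ c : ℝ, 0 < c ∧ ∀ z : ℂ, z.re ∈ K → c ≤ ‖p.eval z‖ := by
  have hprod : ∀ m : Multiset ℂ, (∀ r ∈ m, r.re ∉ K) →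
      ∃ c : ℝ, 0 < c ∧ ∀ z : ℂ, z.re ∈ K → c ≤ ‖(m.map fun r => z - r).prod‖ := by
    intro m hm
    induction m using Multiset.induction_on with
    | empty => exact ⟨1, one_pos, by simp⟩
    | cons r m ih =>
      obtain ⟨c, hc, hcm⟩ := ih fun r hr => hm r (Multiset.mem_cons_of_mem hr)
      obtain ⟨d, hd, hdr⟩ :=
        exists_pos_le_norm_sub_of_re_notMem hK (hm r (Multiset.mem_cons_self r m))
      refine ⟨d * c, by positivity, fun z hz => ?_⟩
      rw [Multiset.map_cons, Multiset.prod_cons, norm_mul]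
      exact mul_le_mul (hdr z hz) (hcm z hz) hc.le (norm_nonneg _)
  rcases eq_or_ne p 0 with rfl | hp0
  · exact ⟨1, one_pos, fun z hz => absurd eval_zero (hp z hz)⟩
  obtain ⟨c, hc, hcp⟩ := hprod p.roots fun r hr hrK => hp r hrK (isRoot_of_mem_roots hr)
  have hlc : 0 < ‖p.leadingCoeff‖ := norm_pos_iff.mpr (leadingCoeff_ne_zero.mpr hp0)
  refine ⟨‖p.leadingCoeff‖ * c, by positivity, fun z hz => ?_⟩
  rw [eval_eq_leadingCoeff_mul_prod_sub, norm_mul]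
  gcongr
  exact hcp z hz

theorem HasPolyGrowth.div_eval {F : ℂ → ℂ} (hF : HasPolyGrowth θ F) {d : ℂ[X]}
    (hd : ∀ z ∈ vstrip θ, d.eval z ≠ 0) : HasPolyGrowth θ fun z => F z / d.eval z := by
  intro K hK hK'
  obtain ⟨c, N, hc, hN, hF⟩ := hF K hK hK'
  obtain ⟨e, he, hde⟩ := exists_pos_le_norm_eval_of_re_mem hK.isClosed fun z hz => hd z (hK' _ hz)
  refine ⟨c / e, N, by positivity, hN, fun z hz => ?_⟩
  rw [norm_div, div_mul_eq_mul_div]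
  exact div_le_div₀ (by positivity) (hF z hz) he (hde z hz)

theorem exists_analytic_sqrt_sub {r : ℂ} (hr : r ∉ vstrip θ) :
    ∃ s : ℂ → ℂ, AnalyticOnNhd ℂ s (vstrip θ) ∧ ∀ z ∈ vstrip θ, s z ^ 2 = z - r := by
  have hsq (w : ℂ) : (w ^ (1 / 2 : ℂ)) ^ 2 = w := by
    rw [one_div]
    exact Complex.cpow_nat_inv_pow w two_ne_zero
  have hlt {z : ℂ} (hz : z ∈ vstrip θ) : |z.re| < |r.re| :=
    (ENNReal.ofReal_lt_ofReal_iff_of_nonneg (abs_nonneg _)).mp (lt_of_lt_of_le hz (not_lt.mp hr))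
  rcases le_total 0 r.re with h | h
  · refine ⟨fun z => Complex.I * (r - z) ^ (1 / 2 : ℂ), fun z hz => ?_, fun z _ => ?_⟩
    · refine analyticAt_const.mul
        ((analyticAt_const.sub analyticAt_id).cpow analyticAt_const (.inl ?_))
      simpa using (abs_lt.mp (abs_of_nonneg h ▸ hlt hz)).2
    · rw [mul_pow, hsq, Complex.I_sq, neg_one_mul, neg_sub]
  · refine ⟨fun z => (z - r) ^ (1 / 2 : ℂ), fun z hz => ?_, fun z _ => hsq _⟩
    refine (analyticAt_id.sub analyticAt_const).cpow analyticAt_const (.inl ?_)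
    have := neg_lt_of_abs_lt (hlt hz)
    rw [abs_of_nonpos h, neg_neg] at this
    simpa using this

theorem exists_analytic_sqrt_prod_sub (m : Multiset ℂ) (hm : ∀ r ∈ m, r ∉ vstrip θ) :
    ∃ s : ℂ → ℂ, AnalyticOnNhd ℂ s (vstrip θ) ∧
      ∀ z ∈ vstrip θ, s z ^ 2 = (m.map fun r => z - r).prod := by
  induction m using Multiset.induction_on with
  | empty => exact ⟨fun _ => 1, fun _ _ => analyticAt_const, fun z _ => by simp⟩
  | cons r m ih =>
    obtain ⟨s, hs, hs_sq⟩ := ih fun r hr => hm r (Multiset.mem_cons_of_mem hr)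
    obtain ⟨t, ht, ht_sq⟩ := exists_analytic_sqrt_sub (hm r (Multiset.mem_cons_self r m))
    refine ⟨fun z => t z * s z, ht.mul hs, fun z hz => ?_⟩
    rw [Multiset.map_cons, Multiset.prod_cons, mul_pow, hs_sq z hz, ht_sq z hz]

theorem exists_analytic_sqrt_eval (p : ℂ[X]) (hp : ∀ z ∈ vstrip θ, p.eval z ≠ 0) :
    ∃ s : ℂ → ℂ, AnalyticOnNhd ℂ s (vstrip θ) ∧ ∀ z ∈ vstrip θ, s z ^ 2 = p.eval z := by
  obtain ⟨s, hs, hs_sq⟩ := exists_analytic_sqrt_prod_sub p.roots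
    fun r hr hrθ => hp r hrθ (isRoot_of_mem_roots hr)
  obtain ⟨c, hc⟩ := IsAlgClosed.exists_pow_nat_eq p.leadingCoeff two_pos
  refine ⟨fun z => c * s z, analyticOnNhd_const.mul hs, fun z hz => ?_⟩
  rw [mul_pow, hc, hs_sq z hz, eval_eq_leadingCoeff_mul_prod_sub]

theorem exists_analytic_sqrt_div {n d : ℂ[X]} (hn : ∀ z ∈ vstrip θ, n.eval z ≠ 0)
    (hd : ∀ z ∈ vstrip θ, d.eval z ≠ 0) : ∃ s : ℂ → ℂ, AnalyticOnNhd ℂ s (vstrip θ) ∧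
      ∀ z ∈ vstrip θ, s z ^ 2 = n.eval z / d.eval z := by
  obtain ⟨t, ht, ht_sq⟩ := exists_analytic_sqrt_eval n hn
  obtain ⟨u, hu, hu_sq⟩ := exists_analytic_sqrt_eval d hd
  have hu0 : ∀ z ∈ vstrip θ, u z ≠ 0 := fun z hz h => hd z hz (by rw [← hu_sq z hz, h]; simp)
  refine ⟨fun z => t z / u z, ht.div hu hu0, fun z hz => ?_⟩
  rw [div_pow, ht_sq z hz, hu_sq z hz]

end Strip

/-! ### The extension of the gain symbol -/

section RationalFunction

variable {𝕜 : Type*} [NontriviallyNormedField 𝕜]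

theorem eventually_nhdsNE_eval_ne_zero {p : 𝕜[X]} (hp : p ≠ 0) (z₀ : 𝕜) :
    ∀ᶠ z in 𝓝[≠] z₀, p.eval z ≠ 0 :=
  nhdsNE_le_cofinite z₀ (finite_setOfPred_isRoot hp).eventually_cofinite_notMem

theorem tendsto_nhdsNE_eval (p : 𝕜[X]) (z₀ : 𝕜) :
    Tendsto (fun z => p.eval z) (𝓝[≠] z₀) (𝓝 (p.eval z₀)) :=
  (p.continuous.tendsto z₀).mono_left nhdsWithin_le_nhds

theorem eval_ne_zero_of_isCoprime {n d : 𝕜[X]} (h : IsCoprime n d) {z : 𝕜} (hn : n.eval z = 0) :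
    d.eval z ≠ 0 := by
  obtain ⟨u, v, huv⟩ := h
  intro hd
  simpa [hn, hd] using congrArg (eval z) huv

theorem tendsto_norm_div_eval_atTop {n d : 𝕜[X]} (hd : d ≠ 0) {z₀ : 𝕜} (hnz : n.eval z₀ ≠ 0)
    (hdz : d.eval z₀ = 0) : Tendsto (fun z => ‖n.eval z / d.eval z‖) (𝓝[≠] z₀) atTop := by
  have hinv : Tendsto (fun z => d.eval z / n.eval z) (𝓝[≠] z₀) (𝓝[≠] 0) := by
    refine tendsto_nhdsWithin_iff.mpr ⟨?_, ?_⟩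
    · rw [← zero_div (n.eval z₀), ← hdz]
      exact (tendsto_nhdsNE_eval d z₀).div (tendsto_nhdsNE_eval n z₀) hnz
    · filter_upwards [eventually_nhdsNE_eval_ne_zero hd z₀,
        (tendsto_nhdsNE_eval n z₀).eventually_ne hnz] with z hd hn using div_ne_zero hd hn
  simpa only [Function.comp_def, inv_div] using tendsto_norm_inv_nhdsNE_zero_atTop.comp hinv

theorem tendsto_div_eval_zero_or_atTop_iff {n d : 𝕜[X]} (h : IsCoprime n d) (hd : d ≠ 0) (z₀ : 𝕜) :
    (Tendsto (fun z => n.eval z / d.eval z) (𝓝[≠] z₀) (𝓝 0) ∨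
        Tendsto (fun z => ‖n.eval z / d.eval z‖) (𝓝[≠] z₀) atTop) ↔
      n.eval z₀ = 0 ∨ d.eval z₀ = 0 := by
  have hlim (hdz : d.eval z₀ ≠ 0) :
      Tendsto (fun z => n.eval z / d.eval z) (𝓝[≠] z₀) (𝓝 (n.eval z₀ / d.eval z₀)) :=
    (tendsto_nhdsNE_eval n z₀).div (tendsto_nhdsNE_eval d z₀) hdz
  constructor
  · intro hz
    by_contra! hne
    rcases hz with hz | hz
    · exact div_ne_zero hne.1 hne.2 (tendsto_nhds_unique (hlim hne.2) hz)
    · exact not_tendsto_nhds_of_tendsto_atTop hz _ (hlim hne.2).norm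
  · rintro (hnz | hdz)
    · exact .inl (by simpa only [hnz, zero_div] using hlim (eval_ne_zero_of_isCoprime h hnz))
    · exact .inr (tendsto_norm_div_eval_atTop hd (eval_ne_zero_of_isCoprime h.symm hdz) hdz)

end RationalFunction

theorem eval_conjPoly_ofReal (p : ℂ[X]) (lam : ℝ) :
    (conjPoly p).eval (lam : ℂ) = conj (p.eval (lam : ℂ)) := by
  have h := eval₂_at_apply (p := p) (starRingEnd ℂ) (lam : ℂ)
  rwa [Complex.conj_ofReal, ← eval_map] at h

theorem neg_I_mul_I_mul (z : ℂ) : -Complex.I * (Complex.I * z) = z := by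
  linear_combination (-z) * Complex.I_mul_I

namespace PlantSymbols

variable (S : PlantSymbols)

theorem reExt_I_mul (lam : ℝ) : S.reExt (Complex.I * lam) = ((S.a.eval (lam : ℂ)).re : ℂ) := by
  rw [reExt, neg_I_mul_I_mul, rePoly, eval_mul, eval_C, eval_add, eval_conjPoly_ofReal,
    Complex.add_conj]
  push_cast
  ring

theorem radicandExt_I_mul (lam : ℝ) : S.radicandExt (Complex.I * lam) = (S.radicand lam : ℂ) := by
  rw [radicandExt, reExt_I_mul, neg_I_mul_I_mul, eval_mul, eval_mul, eval_conjPoly_ofReal,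
    eval_conjPoly_ofReal, Complex.mul_conj', Complex.mul_conj', radicand, symbB, symbG, norm_div,
    norm_div, norm_div]
  push_cast
  field_simp

/-- The denominator of the extended radicand, as a polynomial in `z`; it may have common factors
with `radicandNum`. -/
noncomputable def radicandDen : ℂ[X] :=
  (C ((‖S.g‖ : ℂ) ^ 2) * (S.pB * conjPoly S.pB)).comp (C (-Complex.I) * X)

/-- The numerator of the extended radicand over the denominator `radicandDen`. -/
noncomputable def radicandNum : ℂ[X] :=
  (S.rePoly ^ 2 * (C ((‖S.g‖ : ℂ) ^ 2) * (S.pB * conjPoly S.pB)) +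
    C ((‖S.b‖ : ℂ) ^ 2) * (S.pG * conjPoly S.pG)).comp (C (-Complex.I) * X)

/-- The extended radicand as a rational function, which provides its numerator and denominator in
lowest terms. -/
noncomputable def radicandRat : RatFunc ℂ :=
  algebraMap ℂ[X] (RatFunc ℂ) S.radicandNum / algebraMap ℂ[X] (RatFunc ℂ) S.radicandDen

theorem eval_radicandDen (z : ℂ) : S.radicandDen.eval z =
    (‖S.g‖ : ℂ) ^ 2 * (S.pB * conjPoly S.pB).eval (-Complex.I * z) := by
  simp only [radicandDen, eval_comp, eval_mul, eval_C, eval_X]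

theorem eval_radicandDen_ne_zero {z : ℂ}
    (hz : (S.pB * conjPoly S.pB).eval (-Complex.I * z) ≠ 0) : S.radicandDen.eval z ≠ 0 := by
  rw [eval_radicandDen]
  exact mul_ne_zero (pow_ne_zero _ (Complex.ofReal_ne_zero.mpr (norm_ne_zero_iff.mpr S.g_ne_zero)))
    hz

theorem eval_radicandDen_I_mul_ne_zero (lam : ℝ) : S.radicandDen.eval (Complex.I * lam) ≠ 0 := by
  apply S.eval_radicandDen_ne_zero
  rw [neg_I_mul_I_mul, eval_mul, eval_conjPoly_ofReal]
  exact mul_ne_zero (S.pB_ne_zero lam) ((_root_.map_ne_zero _).mpr (S.pB_ne_zero lam))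

theorem radicandDen_ne_zero : S.radicandDen ≠ 0 := fun h =>
  S.eval_radicandDen_I_mul_ne_zero 0 (by rw [h, eval_zero])

theorem eval_denom_radicandRat_ne_zero {z : ℂ} (hz : S.radicandDen.eval z ≠ 0) :
    S.radicandRat.denom.eval z ≠ 0 := fun h =>
  hz (eval_eq_zero_of_dvd_of_eval_eq_zero (RatFunc.denom_div_dvd _ _) h)

theorem radicandExt_eq_num_div_denom {z : ℂ} (hz : S.radicandDen.eval z ≠ 0) :
    S.radicandExt z = S.radicandRat.num.eval z / S.radicandRat.denom.eval z := by
  have hraw : S.radicandExt z = S.radicandNum.eval z / S.radicandDen.eval z := by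
    rw [eq_div_iff hz, radicandExt, eval_radicandDen, add_mul, div_mul_cancel₀]
    · simp only [radicandNum, eval_comp, eval_add, eval_mul, eval_pow, eval_C, eval_X, reExt]
    · rwa [← eval_radicandDen]
  have hcross := congrArg (eval z) <|
    (RatFunc.num_mul_eq_mul_denom_iff S.radicandDen_ne_zero).mpr (rfl : S.radicandRat = _)
  rw [eval_mul, eval_mul] at hcross
  rw [hraw, div_eq_div_iff hz (S.eval_denom_radicandRat_ne_zero hz), ← hcross]

theorem mem_branchPoints_iff {z : ℂ} : z ∈ S.branchPoints ↔
    S.radicandRat.num.eval z = 0 ∨ S.radicandRat.denom.eval z = 0 := by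
  rw [← tendsto_div_eval_zero_or_atTop_iff S.radicandRat.isCoprime_num_denom
    S.radicandRat.denom_ne_zero]
  have h : S.radicandExt =ᶠ[𝓝[≠] z]
      fun z => S.radicandRat.num.eval z / S.radicandRat.denom.eval z :=
    (eventually_nhdsNE_eval_ne_zero S.radicandDen_ne_zero z).mono
      fun _ => S.radicandExt_eq_num_div_denom
  exact or_congr (tendsto_congr' h) (tendsto_congr' (h.fun_comp _))

theorem I_mul_notMem_branchPoints (lam : ℝ) : Complex.I * lam ∉ S.branchPoints := by
  have hden := S.eval_radicandDen_I_mul_ne_zero lam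
  rw [mem_branchPoints_iff, not_or]
  refine ⟨fun hnum => (S.radicand_pos lam).ne' ?_, S.eval_denom_radicandRat_ne_zero hden⟩
  rw [← Complex.ofReal_eq_zero, ← radicandExt_I_mul, S.radicandExt_eq_num_div_denom hden, hnum,
    zero_div]

theorem finite_branchPoints : S.branchPoints.Finite := by
  have hnum : S.radicandRat.num ≠ 0 := fun h =>
    S.I_mul_notMem_branchPoints 0 (S.mem_branchPoints_iff.mpr (.inl (by rw [h, eval_zero])))
  refine (S.radicandRat.num * S.radicandRat.denom).roots.toFinset.finite_toSet.subset fun z hz => ?_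
  simpa [hnum, S.radicandRat.denom_ne_zero] using S.mem_branchPoints_iff.mp hz

theorem decayRate_pos : 0 < S.decayRate := by
  have hre : ∀ z ∈ S.branchPoints, z.re ≠ 0 := fun z hz h0 =>
    S.I_mul_notMem_branchPoints z.im (by
      convert hz using 1
      exact Complex.ext (by simp [h0]) (by simp))
  have hinf : S.decayRate = S.finite_branchPoints.toFinset.inf fun z => ENNReal.ofReal |z.re| := by
    simp only [decayRate, Finset.inf_eq_iInf, Set.Finite.mem_toFinset]
  rw [hinf, Finset.lt_inf_iff ENNReal.zero_lt_top]
  exact fun z hz => ENNReal.ofReal_pos.mpr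
    (abs_pos.mpr (hre z (S.finite_branchPoints.mem_toFinset.mp hz)))

theorem notMem_branchPoints_of_mem_vstrip {z : ℂ} (hz : z ∈ vstrip S.decayRate) :
    z ∉ S.branchPoints := fun h =>
  (iInf₂_le z h : S.decayRate ≤ ENNReal.ofReal |z.re|).not_gt hz

theorem I_mul_mem_vstrip (lam : ℝ) : Complex.I * lam ∈ vstrip S.decayRate := by
  simpa [vstrip] using S.decayRate_pos

theorem eq_sqrt_or_eq_neg_sqrt_of_sq_eq_radicand {s : ℝ → ℂ} (hs : Continuous s)
    (hsq : ∀ lam, s lam ^ 2 = (S.radicand lam : ℂ)) :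
    (∀ lam, s lam = (√(S.radicand lam) : ℂ)) ∨ ∀ lam, s lam = -(√(S.radicand lam) : ℂ) := by
  have hcont : Continuous fun lam => (√(S.radicand lam) : ℂ) :=
    Complex.continuous_ofReal.comp S.continuous_radicand.sqrt
  have h := isPreconnected_univ.eq_or_eq_neg_of_sq_eq hs.continuousOn hcont.continuousOn
    (fun lam _ => by
      simp only [Pi.pow_apply, hsq lam]
      rw [← Complex.ofReal_pow, Real.sq_sqrt (S.radicand_pos lam).le])
    (fun {lam} _ => Complex.ofReal_ne_zero.mpr (Real.sqrt_pos.mpr (S.radicand_pos lam)).ne')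
  exact h.imp (fun h lam => h (Set.mem_univ lam)) fun h lam => h (Set.mem_univ lam)

theorem exists_analytic_sqrt_radicand : ∃ s : ℂ → ℂ, AnalyticOnNhd ℂ s (vstrip S.decayRate) ∧
    (∀ z ∈ vstrip S.decayRate,
      s z ^ 2 = S.radicandRat.num.eval z / S.radicandRat.denom.eval z) ∧
    ∀ lam : ℝ, s (Complex.I * lam) = (√(S.radicand lam) : ℂ) := by
  have hne := fun z hz =>
    not_or.mp <| S.mem_branchPoints_iff.not.mp (S.notMem_branchPoints_of_mem_vstrip (z := z) hz)
  obtain ⟨s, hs, hsq⟩ :=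
    exists_analytic_sqrt_div (fun z hz => (hne z hz).1) fun z hz => (hne z hz).2
  have himag (lam : ℝ) : s (Complex.I * lam) ^ 2 = (S.radicand lam : ℂ) := by
    rw [hsq _ (S.I_mul_mem_vstrip lam), ← radicandExt_I_mul,
      S.radicandExt_eq_num_div_denom (S.eval_radicandDen_I_mul_ne_zero lam)]
  have hcont : Continuous fun lam : ℝ => s (Complex.I * lam) :=
    hs.continuousOn.comp_continuous (by fun_prop) S.I_mul_mem_vstrip
  rcases S.eq_sqrt_or_eq_neg_sqrt_of_sq_eq_radicand hcont himag with h | h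
  · exact ⟨s, hs, hsq, h⟩
  · exact ⟨fun z => -s z, hs.neg, fun z hz => by rw [neg_sq, hsq z hz],
      fun lam => by simp only [h, neg_neg]⟩

theorem exists_gainExtension : ∃ F : ℂ → ℂ, S.IsGainExtension F ∧
    AnalyticOnNhd ℂ F (vstrip S.decayRate) ∧ HasPolyGrowth S.decayRate F := by
  obtain ⟨s, hs, hsq, himag⟩ := S.exists_analytic_sqrt_radicand
  have hre : S.reExt = fun z => (S.rePoly.comp (C (-Complex.I) * X)).eval z := by
    ext z
    simp only [reExt, eval_comp, eval_mul, eval_C, eval_X]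
  have hgrowth : HasPolyGrowth S.decayRate s :=
    ((hasPolyGrowth_eval S.radicandRat.num).div_eval fun z hz hden =>
      S.notMem_branchPoints_of_mem_vstrip hz (S.mem_branchPoints_iff.mpr (.inr hden))).of_sq_eq hsq
  refine ⟨fun z => S.reExt z + s z, ⟨fun z hz hz' => ?_, fun lam => ?_⟩, ?_, ?_⟩
  · rw [add_sub_cancel_left, hsq z hz,
      S.radicandExt_eq_num_div_denom (S.eval_radicandDen_ne_zero hz')]
  · simp only [reExt_I_mul, himag, gainSymbol_eq, Complex.ofReal_add]
  · exact AnalyticOnNhd.add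
      (fun z _ => hre ▸ (Polynomial.differentiable _).analyticAt z) hs
  · exact HasPolyGrowth.add (hre ▸ hasPolyGrowth_eval _) hgrowth

end PlantSymbols

/-! ### Convolution kernels of polynomially bounded symbols -/

/-- A continuous symbol of polynomial growth: multiplication by it maps Schwartz functions to
integrable functions, so it is the Fourier transform of a tempered distribution. -/
structure IsPolyBounded (m : ℝ → ℂ) : Prop where
  continuous : Continuous m
  exists_norm_le : ∃ (c : ℝ) (N : ℕ), ∀ lam, ‖m lam‖ ≤ c * (1 + |lam|) ^ N

/-- The tempered distribution `L` is the inverse Fourier transform of the symbol `m`. The symbol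
is a function of `lam = 2 π ξ`. -/
def IsKernelOfSymbol (m : ℝ → ℂ) (L : 𝓢'(ℝ, ℂ)) : Prop :=
  ∀ ψ : 𝓢(ℝ, ℂ), L ψ = ∫ ξ : ℝ, m (2 * Real.pi * ξ) * (𝓕⁻ ψ : 𝓢(ℝ, ℂ)) ξ

section SymbolKernel

variable {m : ℝ → ℂ}

theorem IsPolyBounded.comp_mul_left (hm : IsPolyBounded m) (a : ℝ) :
    IsPolyBounded fun x => m (a * x) := by
  obtain ⟨hcont, c, N, hcN⟩ := hm
  refine ⟨by fun_prop, c * (1 + |a|) ^ N, N, fun x => (hcN _).trans ?_⟩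
  have hc : 0 ≤ c := by simpa using (norm_nonneg _).trans (hcN 0)
  rw [mul_assoc, ← mul_pow, abs_mul]
  gcongr
  linarith [abs_nonneg a, abs_nonneg x]

theorem IsPolyBounded.exists_eq_mul (hm : IsPolyBounded m) :
    ∃ g b : ℝ → ℂ, g.HasTemperateGrowth ∧ MemLp b ∞ volume ∧ ∀ x, m x = g x * b x := by
  obtain ⟨hcont, c, N, hcN⟩ := hm
  have hpos (x : ℝ) : 0 < 2 * (1 + x ^ 2) := by positivity
  have hne (x : ℝ) : ((2 * (1 + x ^ 2) : ℝ) : ℂ) ^ N ≠ 0 :=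
    pow_ne_zero _ (Complex.ofReal_ne_zero.mpr (hpos x).ne')
  have hb : Continuous fun x => m x / ((2 * (1 + x ^ 2) : ℝ) : ℂ) ^ N :=
    hcont.div (by fun_prop) hne
  refine ⟨fun x => ((2 * (1 + x ^ 2) : ℝ) : ℂ) ^ N, _, by fun_prop,
    memLp_top_of_bound hb.aestronglyMeasurable c (ae_of_all _ fun x => ?_),
    fun x => (mul_div_cancel₀ _ (hne x)).symm⟩
  have hc : 0 ≤ c := by simpa using (norm_nonneg _).trans (hcN 0)
  rw [norm_div, norm_pow, Complex.norm_of_nonneg (hpos x).le, div_le_iff₀ (pow_pos (hpos x) N)]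
  refine (hcN x).trans ?_
  gcongr
  nlinarith [sq_abs x, sq_nonneg (|x| - 1), abs_nonneg x]

theorem IsPolyBounded.integrable_mul (hm : IsPolyBounded m) (ψ : 𝓢(ℝ, ℂ)) :
    Integrable fun x => m x * ψ x := by
  obtain ⟨g, b, hg, hb, h⟩ := hm.exists_eq_mul
  refine (memLp_one_iff_integrable.mp
    (((SchwartzMap.smulLeftCLM ℂ g ψ).memLp 1).mul hb)).congr (ae_of_all _ fun x => ?_)
  simp only [Pi.mul_apply, SchwartzMap.smulLeftCLM_apply_apply hg, h, smul_eq_mul]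
  ring

theorem IsPolyBounded.exists_distribution (hm : IsPolyBounded m) :
    ∃ T : 𝓢'(ℝ, ℂ), ∀ ψ : 𝓢(ℝ, ℂ), T ψ = ∫ x, m x * ψ x := by
  obtain ⟨g, b, hg, hb, h⟩ := hm.exists_eq_mul
  refine ⟨TemperedDistribution.smulLeftCLM ℂ g (Lp.toTemperedDistribution (hb.toLp b)),
    fun ψ => ?_⟩
  rw [TemperedDistribution.smulLeftCLM_apply_apply, Lp.toTemperedDistribution_apply]
  apply integral_congr_ae
  filter_upwards [hb.coeFn_toLp] with x hx
  simp only [SchwartzMap.smulLeftCLM_apply_apply hg, h, hx, smul_eq_mul]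
  ring

theorem IsPolyBounded.exists_kernel (hm : IsPolyBounded m) :
    ∃ L : 𝓢'(ℝ, ℂ), IsKernelOfSymbol m L := by
  obtain ⟨T, hT⟩ := (hm.comp_mul_left (2 * Real.pi)).exists_distribution
  exact ⟨𝓕⁻ T, fun ψ => by rw [TemperedDistribution.fourierInv_apply, hT]⟩

end SymbolKernel

section FourierInversion

theorem integral_fourierInv_mul {f g : ℝ → ℂ} (hf : Integrable f) (hg : Integrable g) :
    ∫ ξ, (𝓕⁻ f : ℝ → ℂ) ξ * g ξ = ∫ x, f x * (𝓕⁻ g : ℝ → ℂ) x := by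
  have hflip : (-innerₗ ℝ : ℝ →ₗ[ℝ] ℝ →ₗ[ℝ] ℝ).flip = -innerₗ ℝ := by
    ext
    simp
  have h := VectorFourier.integral_fourierIntegral_smul_eq_flip (L := -innerₗ ℝ)
    (μ := (volume : Measure ℝ)) (ν := (volume : Measure ℝ)) Real.continuous_fourierChar
    (by simp only [LinearMap.neg_apply, innerₗ_apply_apply]; fun_prop) hf hg
  rwa [hflip] at h

theorem continuous_fourierInv {g : ℝ → ℂ} (hg : Integrable g) : Continuous (𝓕⁻ g : ℝ → ℂ) :=
  VectorFourier.fourierIntegral_continuous Real.continuous_fourierChar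
    (by simp only [LinearMap.neg_apply, innerₗ_apply_apply]; fun_prop) hg

theorem ae_eq_fourierInv {u : L2R} {g : ℝ → ℂ} (hg : Integrable g)
    (h : (𝓕 u : L2R) =ᵐ[volume] g) : u =ᵐ[volume] (𝓕⁻ g : ℝ → ℂ) := by
  have htest (ψ : 𝓢(ℝ, ℂ)) : ∫ x, ψ x * u x = ∫ x, ψ x * (𝓕⁻ g : ℝ → ℂ) x := by
    have hdist := DFunLike.congr_fun (Lp.fourier_toTemperedDistribution_eq u) (𝓕⁻ ψ)
    rw [TemperedDistribution.fourier_apply, FourierTransform.fourier_fourierInv_eq,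
      Lp.toTemperedDistribution_apply, Lp.toTemperedDistribution_apply] at hdist
    rw [← integral_fourierInv_mul ψ.integrable hg]
    refine hdist.trans (integral_congr_ae ?_)
    filter_upwards [h] with ξ hξ
    rw [hξ, SchwartzMap.fourierInv_coe, smul_eq_mul]
  refine ae_eq_of_integral_contDiff_smul_eq ((Lp.memLp u).locallyIntegrable one_le_two)
    (continuous_fourierInv hg).locallyIntegrable fun w hw hw' => ?_
  have hw_supp : HasCompactSupport (Complex.ofRealCLM ∘ w) := hw'.comp_left rfl
  exact htest (hw_supp.toSchwartzMap (Complex.ofRealCLM.contDiff.comp hw))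

theorem fourierInv_apply_of_eq_comp_sub {φ ψ : 𝓢(ℝ, ℂ)} {x : ℝ} (h : ∀ s, ψ s = φ (x - s))
    (ξ : ℝ) : (𝓕⁻ ψ : 𝓢(ℝ, ℂ)) ξ =
      Complex.exp ((2 * Real.pi * (ξ * x) : ℝ) * Complex.I) * (𝓕 φ : 𝓢(ℝ, ℂ)) ξ := by
  rw [SchwartzMap.fourierInv_coe, SchwartzMap.fourier_coe, Real.fourierInv_eq',
    Real.fourier_real_eq_integral_exp_smul, ← integral_const_mul, ← integral_sub_left_eq_self _ _ x]
  congr 1 with s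
  rw [h, sub_sub_cancel, smul_eq_mul, smul_eq_mul, ← mul_assoc, ← Complex.exp_add]
  congr 2
  simp only [RCLike.inner_apply, conj_trivial]
  push_cast
  ring

end FourierInversion

theorem hasTemperateGrowth_eval (p : ℂ[X]) (a : ℝ) :
    (fun x : ℝ => p.eval ((a * x : ℝ) : ℂ)).HasTemperateGrowth := by
  simp only [eval_eq_sum_range]
  fun_prop

theorem HasFourierSymbol.isConvolutionKernel {T : L2R →ₗ.[ℂ] L2R} {m : ℝ → ℂ}
    (hT : HasFourierSymbol T m) (hm : IsPolyBounded m)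
    (hdom : ∀ φ : 𝓢(ℝ, ℂ), φ.toLp 2 volume ∈ T.domain) {L : 𝓢'(ℝ, ℂ)}
    (hL : IsKernelOfSymbol m L) : IsConvolutionKernel T L := by
  intro φ
  have hgraph := T.mem_graph ⟨φ.toLp 2 volume, hdom φ⟩
  refine ⟨_, hgraph, ?_⟩
  have hfourier : (𝓕 (T ⟨φ.toLp 2 volume, hdom φ⟩) : L2R) =ᵐ[volume]
      fun ξ => m (2 * Real.pi * ξ) * (𝓕 φ : 𝓢(ℝ, ℂ)) ξ := by
    have hφ : (𝓕 (φ.toLp 2 volume) : L2R) = (𝓕 φ : 𝓢(ℝ, ℂ)).toLp 2 volume :=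
      SchwartzMap.toLp_fourier_eq φ
    filter_upwards [hT _ _ hgraph, (𝓕 φ : 𝓢(ℝ, ℂ)).coeFn_toLp 2 volume] with ξ hξ hφξ
    rw [hξ, hφ, hφξ]
  filter_upwards [ae_eq_fourierInv ((hm.comp_mul_left _).integrable_mul (𝓕 φ)) hfourier]
    with x hx ψ hψ
  rw [hx, hL, Real.fourierInv_eq']
  congr 1 with ξ
  rw [fourierInv_apply_of_eq_comp_sub hψ, smul_eq_mul, mul_left_comm]
  simp only [RCLike.inner_apply, conj_trivial, mul_comm x ξ]

theorem HasBoundedFourierSymbol.exists_apply_eq_toLp {T : L2R →L[ℂ] L2R} {m : ℝ → ℂ}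
    (hT : HasBoundedFourierSymbol T m) {p : ℂ[X]} (hp : ∀ lam : ℝ, m lam * p.eval (lam : ℂ) = 1)
    (φ : 𝓢(ℝ, ℂ)) : ∃ s : L2R, T s = φ.toLp 2 volume := by
  have hq := hasTemperateGrowth_eval p (2 * Real.pi)
  let w : 𝓢(ℝ, ℂ) :=
    SchwartzMap.smulLeftCLM ℂ (fun ξ : ℝ => p.eval ((2 * Real.pi * ξ : ℝ) : ℂ)) (𝓕 φ)
  have hw : (𝓕 ((𝓕⁻ w : 𝓢(ℝ, ℂ)).toLp 2 volume) : L2R) = w.toLp 2 volume := by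
    rw [SchwartzMap.toLp_fourier_eq, FourierTransform.fourier_fourierInv_eq]
  have hφ : (𝓕 (φ.toLp 2 volume) : L2R) = (𝓕 φ : 𝓢(ℝ, ℂ)).toLp 2 volume :=
    SchwartzMap.toLp_fourier_eq φ
  refine ⟨(𝓕⁻ w).toLp 2 volume, fourier_ae_injective ?_⟩
  rw [hφ]
  filter_upwards [hT ((𝓕⁻ w).toLp 2 volume), w.coeFn_toLp 2 volume,
    (𝓕 φ : 𝓢(ℝ, ℂ)).coeFn_toLp 2 volume] with ξ hTξ hwξ hφξ
  rw [hTξ, hw, hwξ, hφξ, SchwartzMap.smulLeftCLM_apply_apply hq, smul_eq_mul, ← mul_assoc, hp,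
    one_mul]

namespace PlantSymbols

variable (S : PlantSymbols)

theorem noiseCov_symbol_mul_eval (lam : ℝ) :
    (S.contG * star S.contG) lam *
      (C ((‖S.g‖ : ℂ) ^ 2)⁻¹ * (S.pG * conjPoly S.pG)).eval (lam : ℂ) = 1 := by
  have hpG := Complex.ofReal_ne_zero.mpr (norm_ne_zero_iff.mpr (S.pG_ne_zero lam))
  have hg := Complex.ofReal_ne_zero.mpr (norm_ne_zero_iff.mpr S.g_ne_zero)
  rw [eval_mul, eval_C, eval_mul, eval_conjPoly_ofReal, Complex.mul_conj']
  simp only [contG, ContinuousMap.mul_apply, ContinuousMap.star_apply, ContinuousMap.coe_mk,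
    RCLike.star_def, Complex.mul_conj', symbG, norm_div]
  push_cast
  field_simp

theorem toLp_mem_domain_kalmanGain {G : L2R →L[ℂ] L2R} (hG : HasBoundedFourierSymbol G S.symbG)
    (P : L2R →L[ℂ] L2R) (φ : 𝓢(ℝ, ℂ)) : φ.toLp 2 volume ∈ (kalmanGain G P).domain := by
  have hG' : HasBoundedFourierSymbol G S.contG := hG
  obtain ⟨s, hs⟩ := hG'.mul_adjoint.exists_apply_eq_toLp S.noiseCov_symbol_mul_eval φ
  exact LinearPMap.mem_domain_of_mem_graph
    ((mem_graph_kalmanGain_iff (injective_noiseCov hG' S.symbG_ne_zero)).mpr ⟨s, hs, rfl⟩)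

end PlantSymbols

/-! ### Contour shifts and exponential weights -/

/-- The bilateral Laplace transform `∫ φ(x) e^{zx} dx`, which extends the inverse Fourier transform
of a test function to the complex plane. -/
noncomputable def laplace (φ : ℝ → ℂ) (z : ℂ) : ℂ := ∫ x : ℝ, φ x * Complex.exp (z * x)

section Laplace

theorem integrable_mul_cexp {φ : ℝ → ℂ} (hφ : Continuous φ) (hc : HasCompactSupport φ) (z : ℂ) :
    Integrable fun x : ℝ => φ x * Complex.exp (z * x) :=
  (by fun_prop : Continuous fun x : ℝ => φ x * Complex.exp (z * x)).integrable_of_hasCompactSupport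
    hc.mul_right

theorem norm_cexp_mul_le {ρ : ℝ} {z : ℂ} (hz : |z.re| ≤ ρ) (x : ℝ) :
    ‖Complex.exp (z * x)‖ ≤ Real.exp (ρ * |x|) := by
  rw [Complex.norm_exp, Complex.re_mul_ofReal, Real.exp_le_exp]
  calc z.re * x ≤ |z.re * x| := le_abs_self _
    _ = |z.re| * |x| := abs_mul _ _
    _ ≤ ρ * |x| := by gcongr

theorem differentiable_laplace {φ : ℝ → ℂ} (hφ : Continuous φ) (hc : HasCompactSupport φ) :
    Differentiable ℂ (laplace φ) := by
  intro z₀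
  let bound : ℝ → ℝ := fun x => ‖φ x‖ * (Real.exp ((|z₀.re| + 1) * |x|) * |x|)
  have hbound : Integrable bound :=
    (by fun_prop : Continuous bound).integrable_of_hasCompactSupport hc.norm.mul_right
  have hbound_le (x : ℝ) (z : ℂ) (hz : z ∈ Metric.ball z₀ 1) :
      ‖φ x * (Complex.exp (z * x) * x)‖ ≤ bound x := by
    have hre : |z.re| ≤ |z₀.re| + 1 := by
      have h1 : |z.re - z₀.re| ≤ ‖z - z₀‖ := Complex.abs_re_le_norm (z - z₀)
      have h2 : ‖z - z₀‖ < 1 := mem_ball_iff_norm.mp hz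
      linarith [abs_sub_abs_le_abs_sub z.re z₀.re]
    rw [norm_mul, norm_mul, Complex.norm_real, Real.norm_eq_abs]
    change _ ≤ ‖φ x‖ * (Real.exp ((|z₀.re| + 1) * |x|) * |x|)
    gcongr
    exact norm_cexp_mul_le hre x
  have hderiv (x : ℝ) (z : ℂ) : HasDerivAt (fun z : ℂ => φ x * Complex.exp (z * x))
      (φ x * (Complex.exp (z * x) * x)) z :=
    (by simpa using (hasDerivAt_id z).mul_const (x : ℂ) :
      HasDerivAt (fun z : ℂ => z * (x : ℂ)) (x : ℂ) z).cexp.const_mul (φ x)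
  exact (hasDerivAt_integral_of_dominated_loc_of_deriv_le (Metric.ball_mem_nhds z₀ one_pos)
    (Eventually.of_forall fun z => (integrable_mul_cexp hφ hc z).aestronglyMeasurable)
    (integrable_mul_cexp hφ hc z₀)
    (by fun_prop : Continuous fun x : ℝ =>
      φ x * (Complex.exp (z₀ * x) * x)).aestronglyMeasurable
    (ae_of_all _ hbound_le) hbound (ae_of_all _ fun x z _ => hderiv x z)).2.differentiableAt

theorem hasCompactSupport_derivCLM {φ : 𝓢(ℝ, ℂ)} (hc : HasCompactSupport φ) :
    HasCompactSupport (SchwartzMap.derivCLM ℂ ℂ φ) :=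
  hc.of_isClosed_subset (isClosed_tsupport _) (SchwartzMap.tsupport_derivCLM_subset ℂ φ)

theorem laplace_derivCLM {φ : 𝓢(ℝ, ℂ)} (hc : HasCompactSupport φ) (z : ℂ) :
    laplace (SchwartzMap.derivCLM ℂ ℂ φ) z = -(z * laplace φ z) := by
  have hexp (x : ℝ) : HasDerivAt (fun x : ℝ => Complex.exp (z * x)) (Complex.exp (z * x) * z) x :=
    (by simpa using (Complex.ofRealCLM.hasDerivAt (x := x)).const_mul z :
      HasDerivAt (fun x : ℝ => z * (x : ℂ)) z x).cexp
  have hφ := integrable_mul_cexp φ.continuous hc z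
  have hparts := integral_mul_deriv_eq_deriv_mul_of_integrable
    (u' := SchwartzMap.derivCLM ℂ ℂ φ)
    (fun x _ => (SchwartzMap.derivCLM_apply ℂ φ x).symm ▸ φ.hasDerivAt x)
    (fun x _ => hexp x) (by simpa only [Pi.mul_def, ← mul_assoc] using hφ.mul_const z)
    (integrable_mul_cexp (SchwartzMap.derivCLM ℂ ℂ φ).continuous
      (hasCompactSupport_derivCLM hc) z) hφ
  simp only [← mul_assoc, integral_mul_const] at hparts
  rw [laplace, laplace, mul_comm z, hparts, neg_neg]

theorem exists_pow_mul_norm_laplace_le (ρ : ℝ) (k : ℕ) {φ : 𝓢(ℝ, ℂ)} (hc : HasCompactSupport φ) :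
    ∃ c : ℝ, ∀ z : ℂ, |z.re| ≤ ρ → ‖z‖ ^ k * ‖laplace φ z‖ ≤ c := by
  induction k generalizing φ with
  | zero =>
    have hφ := φ.continuous
    have hbound : Integrable fun x => ‖φ x‖ * Real.exp (ρ * |x|) :=
      (by fun_prop : Continuous fun x =>
        ‖φ x‖ * Real.exp (ρ * |x|)).integrable_of_hasCompactSupport hc.norm.mul_right
    refine ⟨∫ x, ‖φ x‖ * Real.exp (ρ * |x|), fun z hz => ?_⟩
    rw [pow_zero, one_mul]
    refine norm_integral_le_of_norm_le hbound (ae_of_all _ fun x => ?_)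
    rw [norm_mul]
    gcongr
    exact norm_cexp_mul_le hz x
  | succ k ih =>
    obtain ⟨c, h⟩ := ih (hasCompactSupport_derivCLM hc)
    refine ⟨c, fun z hz => ?_⟩
    simpa only [laplace_derivCLM hc, norm_neg, norm_mul, ← mul_assoc, ← pow_succ] using h z hz

theorem exists_one_add_pow_mul_norm_laplace_le (ρ : ℝ) (k : ℕ) {φ : 𝓢(ℝ, ℂ)}
    (hc : HasCompactSupport φ) :
    ∃ c : ℝ, ∀ z : ℂ, |z.re| ≤ ρ → (1 + ‖z‖) ^ k * ‖laplace φ z‖ ≤ c := by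
  obtain ⟨c₀, h₀⟩ := exists_pow_mul_norm_laplace_le ρ 0 hc
  obtain ⟨c₁, h₁⟩ := exists_pow_mul_norm_laplace_le ρ k hc
  simp only [pow_zero, one_mul] at h₀
  refine ⟨2 ^ (k - 1) * (c₀ + c₁), fun z hz => ?_⟩
  calc (1 + ‖z‖) ^ k * ‖laplace φ z‖ ≤ 2 ^ (k - 1) * (1 ^ k + ‖z‖ ^ k) * ‖laplace φ z‖ := by
        gcongr
        exact add_pow_le zero_le_one (norm_nonneg z) k
    _ = 2 ^ (k - 1) * (‖laplace φ z‖ + ‖z‖ ^ k * ‖laplace φ z‖) := by ring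
    _ ≤ 2 ^ (k - 1) * (c₀ + c₁) := by
        gcongr
        exacts [h₀ z hz, h₁ z hz]

theorem fourierInv_eq_laplace (φ : 𝓢(ℝ, ℂ)) (ξ : ℝ) :
    (𝓕⁻ φ : 𝓢(ℝ, ℂ)) ξ = laplace φ ((2 * Real.pi * ξ : ℝ) * Complex.I) := by
  rw [SchwartzMap.fourierInv_coe, Real.fourierInv_eq', laplace]
  congr 1 with x
  rw [smul_eq_mul, mul_comm]
  congr 2
  simp only [RCLike.inner_apply, conj_trivial]
  push_cast
  ring

theorem laplace_add_of_eq_exp_mul {φ ψ : ℝ → ℂ} {η : ℝ}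
    (h : ∀ x, ψ x = (Real.exp (-η * x) : ℂ) * φ x) (z : ℂ) :
    laplace ψ (η + z) = laplace φ z := by
  rw [laplace, laplace]
  congr 1 with x
  rw [h, Complex.ofReal_exp, mul_comm (Complex.exp _), mul_assoc, ← Complex.exp_add]
  congr 2
  push_cast
  ring

end Laplace

section VerticalShift

variable {H : ℂ → ℂ} {a b c : ℝ}

theorem integrable_vertical (hH : ∀ y : ℝ, ContinuousAt H (a + y * Complex.I))
    (hc : ∀ y : ℝ, ‖H (a + y * Complex.I)‖ ≤ c * (1 + y ^ 2)⁻¹) :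
    Integrable fun y : ℝ => H (a + y * Complex.I) := by
  have hcont : Continuous fun y : ℝ => H (a + y * Complex.I) :=
    continuous_iff_continuousAt.mpr fun y =>
      (hH y).comp (f := fun y : ℝ => (a + y * Complex.I : ℂ)) (by fun_prop)
  exact (integrable_inv_one_add_sq.const_mul c).mono' hcont.aestronglyMeasurable (ae_of_all _ hc)

theorem tendsto_integral_horizontal
    (hc : ∀ z : ℂ, z.re ∈ Set.uIcc a b → ‖H z‖ ≤ c * (1 + z.im ^ 2)⁻¹) :
    Tendsto (fun y : ℝ => ∫ x in a..b, H (x + y * Complex.I)) (cocompact ℝ) (𝓝 0) := by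
  have hsq : Tendsto (fun y : ℝ => 1 + y ^ 2) (cocompact ℝ) atTop := by
    have habs := tendsto_atTop_add_const_left (cocompact ℝ) (1 : ℝ)
      ((tendsto_pow_atTop two_ne_zero).comp (tendsto_norm_cocompact_atTop (E := ℝ)))
    simpa only [Function.comp_def, Real.norm_eq_abs, sq_abs] using habs
  have hlim := (hsq.inv_tendsto_atTop.const_mul c).mul_const |b - a|
  rw [mul_zero, zero_mul] at hlim
  refine squeeze_zero_norm (fun y => ?_) hlim
  refine intervalIntegral.norm_integral_le_of_norm_le_const fun x hx => ?_
  simpa using hc (x + y * Complex.I) (by simpa using Set.uIoc_subset_uIcc hx)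

theorem integral_rect_boundary_eq_zero
    (hH : ∀ z : ℂ, z.re ∈ Set.uIcc a b → DifferentiableAt ℂ H z) (R : ℝ) :
    (∫ x in a..b, H (x + (-R : ℝ) * Complex.I)) - (∫ x in a..b, H (x + R * Complex.I)) +
      Complex.I • (∫ y in (-R)..R, H (b + y * Complex.I)) -
      Complex.I • (∫ y in (-R)..R, H (a + y * Complex.I)) = 0 :=
  Complex.integral_boundary_rect_eq_zero_of_differentiableOn H ⟨a, -R⟩ ⟨b, R⟩
    fun z hz => (hH z hz.1).differentiableWithinAt

theorem integral_vertical_eq (hH : ∀ z : ℂ, z.re ∈ Set.uIcc a b → DifferentiableAt ℂ H z)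
    (hc : ∀ z : ℂ, z.re ∈ Set.uIcc a b → ‖H z‖ ≤ c * (1 + z.im ^ 2)⁻¹) :
    ∫ y : ℝ, H (a + y * Complex.I) = ∫ y : ℝ, H (b + y * Complex.I) := by
  have hvert {σ : ℝ} (hσ : σ ∈ Set.uIcc a b) :
      Tendsto (fun R : ℝ => Complex.I • ∫ y in (-R)..R, H (σ + y * Complex.I)) atTop
        (𝓝 (Complex.I • ∫ y : ℝ, H (σ + y * Complex.I))) :=
    (intervalIntegral_tendsto_integral
      (integrable_vertical (fun y => (hH _ (by simpa using hσ)).continuousAt)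
        fun y => by simpa using hc (σ + y * Complex.I) (by simpa using hσ))
      tendsto_neg_atTop_atBot tendsto_id).const_smul Complex.I
  have hhor := tendsto_integral_horizontal hc
  have hlim := (((hhor.comp (tendsto_neg_atTop_atBot.mono_right atBot_le_cocompact)).sub
    (hhor.mono_left atTop_le_cocompact)).add (hvert Set.right_mem_uIcc)).sub
    (hvert Set.left_mem_uIcc)
  have hzero := tendsto_nhds_unique hlim <|
    tendsto_const_nhds.congr fun R => (integral_rect_boundary_eq_zero hH R).symm
  rw [sub_zero, zero_add, sub_eq_zero] at hzero
  exact (smul_right_injective ℂ Complex.I_ne_zero hzero).symm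

end VerticalShift

section ExponentialWeight

variable {θ : ℝ≥0∞} {F : ℂ → ℂ} {η : ℝ}

theorem mem_vstrip_of_abs_re_le (hη : ENNReal.ofReal η < θ) {z : ℂ} (hz : |z.re| ≤ η) :
    z ∈ vstrip θ :=
  (ENNReal.ofReal_le_ofReal hz).trans_lt hη

theorem HasPolyGrowth.isPolyBounded_vertical (hgrowth : HasPolyGrowth θ F)
    (hF : AnalyticOnNhd ℂ F (vstrip θ)) (hη : ENNReal.ofReal |η| < θ) :
    IsPolyBounded fun lam => F (η + lam * Complex.I) := by
  obtain ⟨c, N, hc, -, hcN⟩ := hgrowth {η} isCompact_singleton (by simpa using hη)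
  refine ⟨hF.continuousOn.comp_continuous (by fun_prop) fun lam =>
    mem_vstrip_of_abs_re_le hη (by simp), c * (1 + |η|) ^ N, N, fun lam => ?_⟩
  have hnorm : ‖(η + lam * Complex.I : ℂ)‖ ≤ |η| + |lam| :=
    (norm_add_le _ _).trans_eq (by simp)
  refine (hcN _ (by simp)).trans ?_
  rw [mul_assoc, ← mul_pow]
  gcongr
  nlinarith [abs_nonneg η, abs_nonneg lam]

theorem HasPolyGrowth.exists_norm_mul_laplace_le (hgrowth : HasPolyGrowth θ F)
    (hη : ENNReal.ofReal η < θ) {ψ : 𝓢(ℝ, ℂ)} (hψ : HasCompactSupport ψ) :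
    ∃ c : ℝ, ∀ z : ℂ, |z.re| ≤ η → ‖F z * laplace ψ z‖ ≤ c * (1 + z.im ^ 2)⁻¹ := by
  obtain ⟨c, N, hc, -, hcN⟩ := hgrowth (Set.Icc (-η) η) isCompact_Icc fun r hr =>
    (ENNReal.ofReal_le_ofReal (abs_le.mpr hr)).trans_lt hη
  obtain ⟨e, he⟩ := exists_one_add_pow_mul_norm_laplace_le η (N + 2) hψ
  refine ⟨c * e, fun z hz => ?_⟩
  have him : 1 + z.im ^ 2 ≤ (1 + ‖z‖) ^ 2 := by
    nlinarith [Complex.abs_im_le_norm z, sq_abs z.im, abs_nonneg z.im, norm_nonneg z]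
  rw [← div_eq_mul_inv, le_div_iff₀ (by positivity), norm_mul]
  calc ‖F z‖ * ‖laplace ψ z‖ * (1 + z.im ^ 2)
      ≤ c * (1 + ‖z‖) ^ N * ‖laplace ψ z‖ * (1 + ‖z‖) ^ 2 := by
        gcongr
        exact hcN z (abs_le.mp hz)
    _ = c * ((1 + ‖z‖) ^ (N + 2) * ‖laplace ψ z‖) := by ring
    _ ≤ c * e := by gcongr; exact he z hz

theorem HasPolyGrowth.integral_vertical_mul_laplace (hgrowth : HasPolyGrowth θ F)
    (hF : AnalyticOnNhd ℂ F (vstrip θ)) (hη : ENNReal.ofReal |η| < θ) {ψ : 𝓢(ℝ, ℂ)}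
    (hψ : HasCompactSupport ψ) :
    ∫ y : ℝ, F (η + y * Complex.I) * laplace ψ (η + y * Complex.I) =
      ∫ y : ℝ, F (y * Complex.I) * laplace ψ (y * Complex.I) := by
  have hre {z : ℂ} (hz : z.re ∈ Set.uIcc η 0) : |z.re| ≤ |η| := by
    simpa using Set.abs_sub_right_of_mem_uIcc hz
  obtain ⟨c, hc⟩ := hgrowth.exists_norm_mul_laplace_le hη hψ
  simpa using integral_vertical_eq (H := fun z => F z * laplace ψ z)
    (fun z hz => (hF z (mem_vstrip_of_abs_re_le hη (hre hz))).differentiableAt.mul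
      (differentiable_laplace ψ.continuous hψ z)) fun z hz => hc z (hre hz)

theorem HasPolyGrowth.isTemperedWithWeight (hgrowth : HasPolyGrowth θ F)
    (hF : AnalyticOnNhd ℂ F (vstrip θ)) (hη : ENNReal.ofReal |η| < θ) {L : 𝓢'(ℝ, ℂ)}
    (hL : IsKernelOfSymbol (fun lam => F (lam * Complex.I)) L) : IsTemperedWithWeight η L := by
  obtain ⟨T, hT⟩ := (hgrowth.isPolyBounded_vertical hF hη).exists_kernel
  refine ⟨T, fun φ ψ hφ hψ => ?_⟩
  have hψ_supp : HasCompactSupport ψ :=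
    hφ.mono fun x hx h => hx (by rw [hψ, h, mul_zero])
  have hscale (g : ℝ → ℂ) : ∫ ξ : ℝ, g (2 * Real.pi * ξ) = |(2 * Real.pi)⁻¹| • ∫ y, g y :=
    Measure.integral_comp_mul_left g _
  rw [hT, hL]
  simp only [fourierInv_eq_laplace, ← laplace_add_of_eq_exp_mul hψ]
  rw [hscale fun y => F (η + y * Complex.I) * laplace ψ (η + y * Complex.I),
    hscale fun y => F (y * Complex.I) * laplace ψ (y * Complex.I),
    hgrowth.integral_vertical_mul_laplace hF hη hψ_supp]

end ExponentialWeight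

end KalmanGain

theorem theorem4_general
    (S : PlantSymbols)
    (A : L2R →ₗ.[ℂ] L2R)
    (hA_diff : IsDifferentialOperator A S.a)
    (B G : L2R →L[ℂ] L2R)
    (hB : HasBoundedFourierSymbol B S.symbB)
    (hG : HasBoundedFourierSymbol G S.symbG)
    (P : L2R →L[ℂ] L2R)
    (hP : IsStabilizingSolution A B G P) :
    HasFourierSymbol (kalmanGain G P) (fun lam => (S.gainSymbol lam : ℂ)) ∧
    S.branchPoints.Finite ∧ 0 < S.decayRate ∧
    (∃ F : ℂ → ℂ, S.IsGainExtension F ∧ AnalyticOnNhd ℂ F S.strip ∧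
      ∀ K : Set ℝ, IsCompact K → (∀ r ∈ K, ENNReal.ofReal |r| < S.decayRate) →
        ∃ (c : ℝ) (N : ℕ), 0 < c ∧ 0 < N ∧
          ∀ z : ℂ, z.re ∈ K → ‖F z‖ ≤ c * (1 + ‖z‖) ^ N) ∧
    (∃ L : 𝓢'(ℝ, ℂ), IsConvolutionKernel (kalmanGain G P) L ∧
      ∀ η : ℝ, ENNReal.ofReal |η| < S.decayRate → IsTemperedWithWeight η L) := by
  obtain ⟨F, hext, hF, hgrowth⟩ := S.exists_gainExtension
  have hsymb := S.hasFourierSymbol_kalmanGain hA_diff hB hG hP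
  have hgain : (fun lam => (S.gainSymbol lam : ℂ)) = fun lam : ℝ => F (lam * Complex.I) := by
    funext lam
    rw [mul_comm, hext.2]
  have hpoly : IsPolyBounded fun lam => (S.gainSymbol lam : ℂ) := by
    rw [hgain]
    simpa using hgrowth.isPolyBounded_vertical hF (η := 0) (by simpa using S.decayRate_pos)
  obtain ⟨L, hL⟩ := hpoly.exists_kernel
  exact ⟨hsymb, S.finite_branchPoints, S.decayRate_pos, ⟨F, hext, hF, hgrowth⟩, L,
    hsymb.isConvolutionKernel hpoly (S.toLp_mem_domain_kalmanGain hG P) hL,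
    fun η hη => hgrowth.isTemperedWithWeight hF hη (hgain ▸ hL)⟩

theorem theorem4
    (S : PlantSymbols)
    (A : L2R →ₗ.[ℂ] L2R)
    (hA_dense : Dense (A.domain : Set L2R))
    (hA_diff : IsDifferentialOperator A S.a)
    (hA_gen : ∃ T : C0Semigroup L2R, T.IsGenerator A)
    (B G : L2R →L[ℂ] L2R)
    (hB : HasBoundedFourierSymbol B S.symbB)
    (hG : HasBoundedFourierSymbol G S.symbG)
    (P : L2R →L[ℂ] L2R)
    (hP : IsStabilizingSolution A B G P) :
    -- the gain operator has the Fourier symbol whose extension is considered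
    HasFourierSymbol (kalmanGain G P) (fun lam => (S.gainSymbol lam : ℂ)) ∧
    -- there are finitely many finite branch points, and `θ > 0`
    S.branchPoints.Finite ∧ 0 < S.decayRate ∧
    -- the extension is analytic on the strip and polynomially bounded on closed substrips
    (∃ F : ℂ → ℂ, S.IsGainExtension F ∧ AnalyticOnNhd ℂ F S.strip ∧
      ∀ K : Set ℝ, IsCompact K → (∀ r ∈ K, ENNReal.ofReal |r| < S.decayRate) →
        ∃ (c : ℝ) (N : ℕ), 0 < c ∧ 0 < N ∧
          ∀ z : ℂ, z.re ∈ K → ‖F z‖ ≤ c * (1 + ‖z‖) ^ N) ∧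
    -- spatial decay of the convolution kernel of the gain
    (∃ L : 𝓢'(ℝ, ℂ), IsConvolutionKernel (kalmanGain G P) L ∧
      ∀ η : ℝ, ENNReal.ofReal |η| < S.decayRate → IsTemperedWithWeight η L) :=
  theorem4_general S A hA_diff B G hB hG P hP
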